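/- Let $n\ge 1$ and let $f:\{0,1\}^n\to\{0,1\}$ be a read-once DNF with two terms: there are disjoint nonempty sets $X,Y\subseteq\{1,\dots,n\}$ with $l=|X|\le m=|Y|$, and for each $i\in X\cup Y$ a literal $\lambda_i\in\{x_i,\bar x_i\}$, such that $f=\bigl(\bigwedge_{i\in X}\lambda_i\bigr)\vee\bigl(\bigwedge_{i\in Y}\lambda_i\bigr)$. Inputs $\mathbf x$ are uniform on $\{0,1\}^n$. Decision trees are binary trees whose internal nodes are labelled by features $i\in\{1,\dots,n\}$ (any features, also ones not occurring in $f$); the left child is followed if $x_i=0$ and the right child if $x_i=1$. The size of a tree is its number of internal nodes, and $\mathcal T_t$ is the set of trees of size at most $t$. For a node $v$, let $p(v)$ be the probability that $\mathbf x$ reaches $v$ and $q(v)$ the probability of $f(\mathbf x)=1$ given that $\mathbf x$ reaches $v$. A leaf $v$ is labelled $1$ if $q(v)\ge\frac12$ and $0$ otherwise. The test error is $E(T)=\Pr[T(\mathbf x)\ne f(\mathbf x)]$. A tree of $\mathcal T_t$ is optimal in $\mathcal T_t$ if its test error is least among all trees of $\mathcal T_t$. Let $H(T)=\sum_{v\text{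 leaf of }T}p(v)H(q(v))$, where $H(z)=-z\log_2 z-(1-z)\log_2(1-z)$. TopDown starts with $T_0$, a single leaf. In each iteration it chooses a leaf $v$ of the current tree $T$ and a feature $i$ not occurring on the path from the root to $v$, such that $H(T)-H(T')$ is maximal among all such pairs, where $T'$ is $T$ with $v$ replaced by an internal node labelled $i$ that has two leaves; it replaces $T$ by $T'$. Ties are broken in an arbitrary way, and if no such pair exists the tree stays unchanged. $T_t$ is the tree after $t$ iterations. For a tree $T$ all of whose internal nodes are labelled in $X\cup Y$, call the child of an internal node for which the literal of that node is true its positive child, and the other one its negative child (these are the right and the left child if all literals are unnegated). The main path of $T$ consists of the internal nodes met when one starts at the root and always follows the positive child. A $Y$-path is a tree (possibly a single leaf) all of whose internal nodes are on its main path and are labelled by distinct elements of $Y$; it is full if it has $m$ internal nodes. A tree $T$ is a tree $B_t$ for $(X,Y)$ if - $T$ has size $t$; - the nodes of its main path are labelled by distinct elements of $X$; - the subtree at the negative child of each node of the main path is a $Y$-path; - if some of these negative subtrees is not a leaf, then the main path has $l$ nodes; - if $v_1,v_2$ are on the main path, $v_2$ deeper than $v_1$, and the negative subtree of $v_2$ is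 not a leaf, then the negative subtree of $v_1$ is a full $Y$-path. So, for $1\le t\le l$, $B_t$ is a path of $t$ $X$-nodes; for $l\le t\le l(m+1)$ it is the full path of $l$ $X$-nodes, with negative subtrees filled by $Y$-paths from top to bottom. It is unique up to the choice of the variables of a term along the paths, and it exists exactly for $t\le l(m+1)$. If $l=m$, the roles of $X$ and $Y$ may also be exchanged. **Theorem.** TopDown has at least one run on $f$, and for every run (that is, for every way of breaking ties): 1. For every $t$ with $1\le t\le l(m+1)$, $T_t$ is a tree $B_t$ for $(X,Y)$ or, if $l=m$, a tree $B_t$ for $(X,Y)$ or for $(Y,X)$. 2. For every $t\ge1$, $T_t$ is optimal in $\mathcal T_t$. 3. For every $t\ge l(m+1)$, $E(T_t)=0$. Moreover, for every $t\ge1$, every tree $B_t$ for $(X,Y)$ is optimal in $\mathcal T_t$. -/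

import Mathlib

/-- The domain `{0,1}^n`. -/
abbrev Input (n : ℕ) := Fin n → Bool

/-- Probability of an event when the input is uniform on `{0,1}^n`. -/
noncomputable def prob {n : ℕ} (A : Input n → Prop) [DecidablePred A] : ℝ :=
  ((Finset.univ.filter A).card : ℝ) / 2 ^ n

/-- The DNF with the two terms `⋀_{i ∈ X} (x_i = s i)` and `⋀_{i ∈ Y} (x_i = s i)`; the polarity
`s i` is `true` for the literal `x_i` and `false` for its negation. -/
def twoTermDNF {n : ℕ} (s : Fin n → Bool) (X Y : Finset (Fin n)) (x : Input n) : Bool :=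
  decide (∀ i ∈ X, x i = s i) || decide (∀ i ∈ Y, x i = s i)

/-- Decision trees on `n` features. The first subtree of `node i L R` is the left one, followed
when `x_i = 0`; the second is the right one, followed when `x_i = 1`. Leaf labels are not stored:
they are the majority labels, see `DTree.label`. -/
inductive DTree (n : ℕ) : Type
  | leaf : DTree n
  | node (i : Fin n) (L R : DTree n) : DTree n

namespace DTree

variable {n : ℕ}

/-- Number of internal nodes. -/
def size : DTree n → ℕ
  | leaf => 0
  | node _ L R => L.size + R.size + 1

/-- A node is addressed by the list of turns from the root (`false` is left, `true` is right).
This is the set of (the addresses of) the leaves. -/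
def leaves : DTree n → Finset (List Bool)
  | leaf => {[]}
  | node _ L R => L.leaves.image (fun v => false :: v) ∪ R.leaves.image (fun v => true :: v)

/-- The leaf that an input reaches. -/
def route : DTree n → Input n → List Bool
  | leaf, _ => []
  | node i L R, x => x i :: (if x i then R.route x else L.route x)

/-- The features on the path from the root to (but not including) a node. -/
def pathFeatures : DTree n → List Bool → Finset (Fin n)
  | leaf, _ => ∅
  | node _ _ _, [] => ∅
  | node i L R, b :: v => insert i (if b then R.pathFeatures v else L.pathFeatures v)

/-- `T(l, i)`: the leaf `l` is replaced by an internal node labelled by `i` with two leaves. -/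
def split : DTree n → List Bool → Fin n → DTree n
  | leaf, [], i => node i leaf leaf
  | leaf, _ :: _, _ => leaf
  | node j L R, [], _ => node j L R
  | node j L R, b :: v, i => if b then node j L (R.split v i) else node j (L.split v i) R

/-- `p(v)`: the probability that a random input reaches the node `v`. -/
noncomputable def p (T : DTree n) (v : List Bool) : ℝ :=
  prob (fun x => v <+: T.route x)

/-- `q(v)`: the conditional probability of `f = 1` given that the node `v` is reached. -/
noncomputable def q (f : Input n → Bool) (T : DTree n) (v : List Bool) : ℝ :=
  prob (fun x => v <+: T.route x ∧ f x = true) / T.p v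

/-- The majority label of a leaf. -/
noncomputable def label (f : Input n → Bool) (T : DTree n) (v : List Bool) : Bool :=
  open Classical in decide (1 / 2 ≤ T.q f v)

/-- The prediction `T(x)`. -/
noncomputable def predict (f : Input n → Bool) (T : DTree n) (x : Input n) : Bool :=
  T.label f (T.route x)

/-- The test error `E(T)`. -/
noncomputable def err (f : Input n → Bool) (T : DTree n) : ℝ :=
  prob (fun x => T.predict f x ≠ f x)

/-- The entropy `H(T) = ∑_l p(l) H(q(l))`, with the binary entropy `H` in base 2. -/
noncomputable def entropy (f : Input n → Bool) (T : DTree n) : ℝ :=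
  ∑ l ∈ T.leaves, T.p l * (Real.binEntropy (T.q f l) / Real.log 2)

/-- The weighted gain `H(T) - H(T(l, i))`. -/
noncomputable def gain (f : Input n → Bool) (T : DTree n) (l : List Bool) (i : Fin n) : ℝ :=
  T.entropy f - (T.split l i).entropy f

/-- One iteration of TopDown, with any rule for breaking ties: split a leaf `l` on a feature `i`
that is not on the path to `l`, such that the gain is maximal among all such pairs. If there is no
such pair at all, then the tree stays as it is. -/
def IsTopDownStep (f : Input n → Bool) (T T' : DTree n) : Prop :=
  (∃ l ∈ T.leaves, ∃ i ∉ T.pathFeatures l,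
    (∀ l' ∈ T.leaves, ∀ i' ∉ T.pathFeatures l', T.gain f l' i' ≤ T.gain f l i) ∧
      T' = T.split l i) ∨
  ((∀ l ∈ T.leaves, ∀ i, i ∈ T.pathFeatures l) ∧ T' = T)

/-- `T t` is the tree after `t` iterations in some run of TopDown on the target `f`. -/
def IsTopDownRun (f : Input n → Bool) (T : ℕ → DTree n) : Prop :=
  T 0 = leaf ∧ ∀ t, IsTopDownStep f (T t) (T (t + 1))

/-- `T` has at most `t` internal nodes, and the least test error among all such trees. -/
def IsOptimal (f : Input n → Bool) (t : ℕ) (T : DTree n) : Prop :=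
  T.size ≤ t ∧ ∀ S : DTree n, S.size ≤ t → T.err f ≤ S.err f

/-- The internal nodes met when one starts at the root and always follows the child for which the
literal of the current node is satisfied (the right-path, if all literals are positive), from top
to bottom. Each is listed with its feature and its other subtree (the left one, if all literals are
positive). -/
def spine (s : Fin n → Bool) : DTree n → List (Fin n × DTree n)
  | leaf => []
  | node i L R => if s i then (i, L) :: R.spine s else (i, R) :: L.spine s

/-- `T` consists of a right-path only, whose nodes are labelled by distinct features in `Z`. It is
a full right-path if moreover `T.size = Z.card`. -/
def IsRightPath (s : Fin n → Bool) (Z : Finset (Fin n)) (T : DTree n) : Prop :=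
  (∀ e ∈ T.spine s, e.1 ∈ Z ∧ e.2 = leaf) ∧ ((T.spine s).map Prod.fst).Nodup

/-- `T` is a tree `B_t` for the DNF with terms on `X` and `Y`. It has `t` internal nodes. Its
right-path has distinct `X`-nodes only, and the left subtree of each of them is a right-path of
`Y`-nodes. There are nonempty left subtrees only if the right-path has all the `|X|` nodes, and
a left subtree is nonempty only if all the left subtrees above it are full. -/
def IsB (s : Fin n → Bool) (X Y : Finset (Fin n)) (t : ℕ) (T : DTree n) : Prop :=
  T.size = t ∧
  (∀ e ∈ T.spine s, e.1 ∈ X ∧ IsRightPath s Y e.2) ∧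
  ((T.spine s).map Prod.fst).Nodup ∧
  ((∃ e ∈ T.spine s, e.2 ≠ leaf) → (T.spine s).length = X.card) ∧
  (T.spine s).Pairwise (fun e₁ e₂ => e₂.2 ≠ leaf → e₁.2.size = Y.card)

end DTree

/-! Inputs that agree with given values on a set `D` of features form a cell. All that matters about
a cell is its size, which terms are still satisfiable on it, and how many literals of each are
unset. Errors and entropies are sums over leaves of functions of cells (`err_eq`, `entropy_eq`), so
both halves of the proof are inductions over trees that carry this state along.

Optimality. Call the number of errors that majority labels avoid, compared with the constant
prediction `0`, the saving; the error is least when the saving is greatest. `stateSaving` is a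
closed form for the greatest relative saving in a given state. It satisfies the inequality that
belongs to querying one literal (`stateSaving_step`), which bounds every tree
(`IsCell.leafSum_saving_le`), and the trees `B_t` attain it (`IsB.leafSum_saving`).

TopDown. Write `g(w) = H(w) - H(2w)/2`, in nats, for the gain of querying a literal of a lone term
of probability `w`, and `termGain u w` for the gain when another term of probability `w` is still
alive. Three comparisons determine the run. At the root, a literal of the more probable term gains
more (`termGain_lt_termGain`), by strict concavity. On an incomplete `X`-path, extending it beats
starting a `Y`-path: the product of the cell probability and the probability `u` of the rest of the
`X`-term stays `2^(-l)` along the path, and `termGain u w > u g(w) / (2w)` when `w ≤ u/2`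
(`lt_termGain`, the analytic core), so the gain exceeds `2^(-l) g(w) / (2w) ≥ g(w)/2` for `w =
2^(-m)`, which is the most that a negative leaf offers. Once the `X`-path is complete, `w log 2 <
g(w) ≤ 2 w log 2`; along a `Y`-path the product of cell probability and term probability is again
constant, and it halves from one negative subtree to the next. Hence the topmost `Y`-path that is
not full always wins. -/

/-! ### Entropy inequalities for a single query -/

/-- The deficit `η(1-u) - η(1-2u)/2` of the function `η(z) = -z log z` below `1`. -/
noncomputable def negMulLogGap (u : ℝ) : ℝ :=
  Real.negMulLog (1 - u) - Real.negMulLog (1 - 2 * u) / 2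

/-- The probability of a disjunction of two independent events. -/
def orProb (u w : ℝ) : ℝ := 1 - (1 - u) * (1 - w)

/-- The entropy gain of querying a literal of a term of probability `u`, when the function is the
disjunction of this term and an independent event of probability `w`. -/
noncomputable def termGain (u w : ℝ) : ℝ :=
  Real.binEntropy (orProb u w) - Real.binEntropy (orProb (2 * u) w) / 2
    - Real.binEntropy (orProb 0 w) / 2

/-- Since `1 - 2w ≤ (1 - w)^2`, the second logarithm is at most twice the first. -/
theorem negMulLogGap_le {w : ℝ} (h0 : 0 < w) (h1 : w ≤ 1 / 2) :
    negMulLogGap w ≤ -(w * Real.log (1 - w)) := by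
  unfold negMulLogGap Real.negMulLog
  rcases h1.eq_or_lt with rfl | h1
  · norm_num
  · have h : Real.log (1 - 2 * w) ≤ 2 * Real.log (1 - w) := by
      rw [← Real.log_rpow (by linarith)]
      apply Real.log_le_log (by linarith)
      norm_num
      nlinarith
    nlinarith

/-- The cubic term is kept because `lt_termGain` has little slack; for `u ≥ 2w` the bracket is at
least `w + 2w^2`. -/
theorem negMulLogGap_ge {u : ℝ} (h0 : 0 < u) (h1 : u ≤ 1 / 2) :
    u * (u / 2 + u ^ 2 / 2) ≤ negMulLogGap u := by
  have hl : u + u ^ 2 / 2 ≤ -Real.log (1 - u) := by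
    have := Real.le_log_one_add_of_nonneg (x := u / (1 - u)) (by apply div_nonneg <;> linarith)
    have e1 : 1 + u / (1 - u) = (1 - u)⁻¹ := by
      field_simp [show (1 - u) ≠ 0 by linarith]; ring
    have e2 : 2 * (u / (1 - u)) / (u / (1 - u) + 2) = 2 * u / (2 - u) := by
      have : (1 - u) ≠ 0 := by linarith
      have : (2 - u) ≠ 0 := by linarith
      have : u / (1 - u) + 2 = (2 - u) / (1 - u) := by field_simp; ring
      rw [this]; field_simp
    rw [e1, e2, Real.log_inv] at this
    refine le_trans ?_ this
    rw [le_div_iff₀ (by linarith)]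
    nlinarith [mul_pos h0 h0, mul_pos (mul_pos h0 h0) h0]
  have h2 : 2 * Real.log (1 - u) * (1 - 2 * u) - u ^ 2 ≤ (1 - 2 * u) * Real.log (1 - 2 * u) := by
    rcases h1.eq_or_lt with rfl | h1
    · norm_num
    · have hp : 0 < (1 - 2 * u) := by linarith
      have hq : 0 < (1 - u) := by linarith
      -- This bounds the loss in replacing `log (1 - 2u)` by `2 log (1 - u)`.
      have := Real.one_sub_inv_le_log_of_pos (x := (1 - 2 * u) / (1 - u) ^ 2) (by positivity)
      rw [Real.log_div hp.ne' (by positivity), Real.log_pow] at this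
      have e : 1 - ((1 - 2 * u) / (1 - u) ^ 2)⁻¹ = - u ^ 2 / (1 - 2 * u) := by
        field_simp; ring
      rw [e, div_le_iff₀ hp] at this
      push_cast at this
      linarith
  unfold negMulLogGap Real.negMulLog
  nlinarith

theorem binEntropy_sub_half {w : ℝ} (h0 : 0 < w) :
    Real.binEntropy w - Real.binEntropy (2 * w) / 2 = w * Real.log 2 + negMulLogGap w := by
  rw [Real.binEntropy_eq_negMulLog_add_negMulLog_one_sub,
    Real.binEntropy_eq_negMulLog_add_negMulLog_one_sub]
  unfold negMulLogGap
  simp only [Real.negMulLog]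
  rw [Real.log_mul (by norm_num) h0.ne']
  ring

/-- With `binEntropy_sub_half_le`, this confines the gain divided by `w` to `(log 2, 2 log 2]`. The
endpoints have ratio two, exactly the factor lost between consecutive negative subtrees, and the
strict lower end rules out ties between them. -/
theorem lt_binEntropy_sub_half {w : ℝ} (h0 : 0 < w) (h1 : w ≤ 1 / 2) :
    w * Real.log 2 < Real.binEntropy w - Real.binEntropy (2 * w) / 2 := by
  rw [binEntropy_sub_half h0]
  have := negMulLogGap_ge h0 h1
  have : 0 < w * (w / 2 + w ^ 2 / 2) := by positivity
  linarith

theorem binEntropy_sub_half_le {w : ℝ} (h0 : 0 < w) (h1 : w ≤ 1 / 2) :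
    Real.binEntropy w - Real.binEntropy (2 * w) / 2 ≤ 2 * (w * Real.log 2) := by
  rw [binEntropy_sub_half h0]
  have := negMulLogGap_le h0 h1
  have h2 : -Real.log (1 - w) ≤ Real.log 2 := by
    rw [← Real.log_inv]
    apply Real.log_le_log (inv_pos.2 (by linarith))
    rw [inv_le_comm₀ (by linarith) (by norm_num)]
    linarith
  nlinarith

/-- Both `b` and `c` are convex combinations of `a` and `d`, with the two weights interchanged; the
two strict concavity inequalities add up to the claim. -/
theorem StrictConcaveOn.add_lt_add_of_add_eq {f : ℝ → ℝ} {S : Set ℝ} (hf : StrictConcaveOn ℝ S f)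
    {a b c d : ℝ} (ha : a ∈ S) (hd : d ∈ S) (hab : a < b) (hac : a < c) (h : a + d = b + c) :
    f a + f d < f b + f c := by
  have hpos : 0 < d - a := by linarith
  have hne : a ≠ d := fun e => by linarith
  have h1 := hf.2 ha hd hne (show 0 < (d - b) / (d - a) from div_pos (by linarith) hpos)
    (show 0 < (b - a) / (d - a) from div_pos (by linarith) hpos) (by field_simp; ring)
  have h2 := hf.2 ha hd hne (show 0 < (d - c) / (d - a) from div_pos (by linarith) hpos)
    (show 0 < (c - a) / (d - a) from div_pos (by linarith) hpos) (by field_simp; ring)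
  have e1 : ((d - b) / (d - a)) • a + ((b - a) / (d - a)) • d = b := by
    simp only [smul_eq_mul]; field_simp; ring
  have e2 : ((d - c) / (d - a)) • a + ((c - a) / (d - a)) • d = c := by
    simp only [smul_eq_mul]; field_simp; ring
  rw [e1] at h1
  rw [e2] at h2
  simp only [smul_eq_mul] at h1 h2
  have e3 : (d - b) / (d - a) + (d - c) / (d - a) = 1 := by field_simp; linarith
  have e4 : (b - a) / (d - a) + (c - a) / (d - a) = 1 := by field_simp; linarith
  have e5 : f a + f d = ((d - b) / (d - a) + (d - c) / (d - a)) * f a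
      + ((b - a) / (d - a) + (c - a) / (d - a)) * f d := by rw [e3, e4]; ring
  rw [e5]
  linarith

theorem orProb_mem {u w : ℝ} (hu : u ∈ Set.Icc 0 1) (hw : w ∈ Set.Icc 0 1) :
    orProb u w ∈ Set.Icc 0 1 := by
  obtain ⟨h1, h2⟩ := hu
  obtain ⟨h3, h4⟩ := hw
  unfold orProb
  constructor
  · nlinarith [mul_nonneg h1 (sub_nonneg.2 h4)]
  · nlinarith [mul_nonneg (sub_nonneg.2 h2) (sub_nonneg.2 h4)]

/-- Querying the more probable term gains more. -/
theorem termGain_lt_termGain {u w : ℝ} (hw : 0 < w) (h : w < u) (hu : u ≤ 1 / 2) :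
    termGain w u < termGain u w := by
  -- The two queries lead to pairs of child probabilities with the same mean; the pair of the more
  -- probable term is more spread out.
  have := Real.strictConcave_binEntropy.add_lt_add_of_add_eq
    (a := orProb 0 w) (b := orProb 0 u) (c := orProb (2 * w) u) (d := orProb (2 * u) w)
    (orProb_mem (by simp) ⟨hw.le, by linarith⟩)
    (orProb_mem ⟨by linarith, by linarith⟩ ⟨hw.le, by linarith⟩)
    (by unfold orProb; linarith) (by unfold orProb; nlinarith) (by unfold orProb; ring)
  have e : orProb u w = orProb w u := by unfold orProb; ring
  unfold termGain
  rw [e]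
  linarith

theorem termGain_pos {u w : ℝ} (hu : 0 < u) (hu' : u ≤ 1 / 2) (hw : 0 ≤ w) (hw' : w < 1) :
    0 < termGain u w := by
  have := Real.strictConcave_binEntropy.add_lt_add_of_add_eq
    (a := orProb 0 w) (b := orProb u w) (c := orProb u w) (d := orProb (2 * u) w)
    (orProb_mem (by simp) ⟨hw, by linarith⟩)
    (orProb_mem ⟨by linarith, by linarith⟩ ⟨hw, by linarith⟩)
    (by unfold orProb; nlinarith) (by unfold orProb; nlinarith) (by unfold orProb; ring)
  unfold termGain
  linarith

/-- A literal of a term gains more than half as much, relative to the probability of the term, as a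
literal of a term that is at most half as probable and whose companion is already false. -/
theorem lt_termGain {u w : ℝ} (hw : 0 < w) (h : w ≤ u / 2) (hu : u ≤ 1 / 2) :
    u / (2 * w) * (Real.binEntropy w - Real.binEntropy (2 * w) / 2) < termGain u w := by
  have hu0 : 0 < u := by linarith
  set P := u + w - u * w with hP
  set Q := 2 * u + w - 2 * u * w with hQ
  have hPp : 0 < P := by rw [hP]; nlinarith
  have hQp : 0 < Q := by rw [hQ]; nlinarith
  -- The probabilities of the value `0` are multiples of `1 - w` and give the first summand. Those
  -- of the value `1` give the Jensen gap of `x log x` at `Q` and `w`, whose mean is `P`.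
  have hgain : termGain u w = (1 - w) * negMulLogGap u
      + (Q * Real.log (Q / P) / 2 + w * Real.log (w / P) / 2) := by
    have e1 : orProb u w = P := by unfold orProb; rw [hP]; ring
    have e2 : orProb (2 * u) w = Q := by unfold orProb; rw [hQ]; ring
    have e3 : orProb 0 w = w := by unfold orProb; ring
    unfold termGain
    simp only [Real.binEntropy_eq_negMulLog_add_negMulLog_one_sub]
    rw [e1, e2, e3]
    have f1 : 1 - P = (1 - u) * (1 - w) := by rw [hP]; ring
    have f2 : 1 - Q = (1 - 2 * u) * (1 - w) := by rw [hQ]; ring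
    rw [f1, f2, Real.negMulLog_mul, Real.negMulLog_mul, Real.log_div hQp.ne' hPp.ne',
      Real.log_div hw.ne' hPp.ne']
    unfold negMulLogGap Real.negMulLog
    rw [hP, hQ]
    ring
  -- Gibbs' inequality against the distribution `(5/6, 1/6)`. This is the limit of `(Q, w) / (2P)`
  -- for `u = 2w` and `w → 0`, the critical regime.
  have hB : Q * Real.log (5 / 3) / 2 + w * Real.log (1 / 3) / 2 ≤
      Q * Real.log (Q / P) / 2 + w * Real.log (w / P) / 2 := by
    have h1 := Real.one_sub_inv_le_log_of_pos (x := (Q / P) / (5 / 3)) (by positivity)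
    have h2 := Real.one_sub_inv_le_log_of_pos (x := (w / P) / (1 / 3)) (by positivity)
    rw [Real.log_div (by positivity) (by norm_num)] at h1 h2
    have h3 := mul_le_mul_of_nonneg_left h1 hQp.le
    have h4 := mul_le_mul_of_nonneg_left h2 hw.le
    have e3 : Q * (1 - (Q / P / (5 / 3))⁻¹) = Q - 5 / 3 * P := by field_simp
    have e4 : w * (1 - (w / P / (1 / 3))⁻¹) = w - 1 / 3 * P := by field_simp
    rw [e3] at h3
    rw [e4] at h4
    have : Q + w = 2 * P := by rw [hP, hQ]; ring
    linarith
  have hc : Real.log (5 / 3) ≤ 511 / 1000 := by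
    have h1 := Real.log_le_sub_one_of_pos (x := 25 / 9 / Real.exp 1) (by positivity)
    rw [Real.log_div (by norm_num) (by positivity), Real.log_exp,
      show (25 / 9 : ℝ) = (5 / 3) ^ 2 by norm_num, Real.log_pow] at h1
    have h2 : (5 / 3 : ℝ) ^ 2 / Real.exp 1 ≤ 1022 / 1000 := by
      rw [div_le_iff₀ (by positivity)]
      nlinarith [Real.exp_one_gt_d9]
    push_cast at h1
    linarith
  -- The slack at `w = 0`; it equals `log (3125/2916) / 4`.
  have hd : 167 / 10000 ≤ Real.log (5 / 3) + Real.log (1 / 3) / 4 + Real.log (5 / 3) / 4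
      - Real.log 2 / 2 := by
    have h1 := Real.one_sub_inv_le_log_of_pos (x := 3125 / 2916) (by norm_num)
    have e : Real.log (3125 / 2916) = 5 * Real.log (5 / 3) + Real.log (1 / 3) - 2 * Real.log 2 := by
      rw [show (3125 / 2916 : ℝ) = (5 / 3) ^ 5 * (1 / 3) / 2 ^ 2 by norm_num,
        Real.log_div (by norm_num) (by norm_num), Real.log_mul (by norm_num) (by norm_num),
        Real.log_pow, Real.log_pow]
      push_cast
      ring
    rw [e] at h1
    norm_num at h1 ⊢
    linarith
  have hs : Real.log (5 / 3) + Real.log (1 / 3) ≤ 0 := by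
    rw [← Real.log_mul (by norm_num) (by norm_num)]
    exact Real.log_nonpos (by norm_num) (by norm_num)
  have hk1 : negMulLogGap w / w ≤ w / (1 - w) := by
    have h1 := negMulLogGap_le hw (by linarith)
    have h2 := Real.one_sub_inv_le_log_of_pos (x := 1 - w) (by linarith)
    have e : 1 - (1 - w)⁻¹ = - (w / (1 - w)) := by
      have : 1 - w ≠ 0 := by linarith
      field_simp; ring
    rw [div_le_iff₀ hw]
    nlinarith
  have hk2 := negMulLogGap_ge hu0 hu
  have hk3 : w / (1 - w) ≤ w + w ^ 2 + 4 / 3 * w ^ 3 := by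
    rw [div_le_iff₀ (by linarith)]
    nlinarith [mul_nonneg (pow_pos hw 3).le (show (0 : ℝ) ≤ 1 / 4 - w by linarith)]
  have hlhs : u / (2 * w) * (Real.binEntropy w - Real.binEntropy (2 * w) / 2)
      = u * (Real.log 2 / 2 + negMulLogGap w / w / 2) := by
    rw [binEntropy_sub_half hw]
    field_simp
  rw [hlhs, hgain]
  -- By `hs` the remaining multiple of `w` has a nonpositive coefficient, so `w` may be replaced
  -- there by `u / 2`; then `u` factors out.
  have hB2 : u * ((1 - w) * Real.log (5 / 3) + Real.log (5 / 3) / 4 + Real.log (1 / 3) / 4) ≤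
      Q * Real.log (5 / 3) / 2 + w * Real.log (1 / 3) / 2 := by
    rw [hQ]
    nlinarith
  have hA : u * ((1 - w) * (w + 2 * w ^ 2)) ≤ (1 - w) * negMulLogGap u := by
    have : u * (w + 2 * w ^ 2) ≤ negMulLogGap u := by
      refine le_trans (mul_le_mul_of_nonneg_left ?_ hu0.le) hk2
      nlinarith
    nlinarith
  have hfin : Real.log 2 / 2 + negMulLogGap w / w / 2 < (1 - w) * (w + 2 * w ^ 2) +
      ((1 - w) * Real.log (5 / 3) + Real.log (5 / 3) / 4 + Real.log (1 / 3) / 4) := by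
    have hw4 : w ≤ 1 / 4 := by linarith
    have hwc : w * Real.log (5 / 3) ≤ w * (511 / 1000) := mul_le_mul_of_nonneg_left hc hw.le
    have hpoly : w * (511 / 1000) + (w + w ^ 2 + 4 / 3 * w ^ 3) / 2
        < 167 / 10000 + (1 - w) * (w + 2 * w ^ 2) := by
      nlinarith [mul_nonneg hw.le (sub_nonneg.2 hw4), mul_nonneg (mul_nonneg hw.le hw.le) (sub_nonneg.2 hw4)]
    linarith
  have := mul_lt_mul_of_pos_left hfin hu0
  linarith

/-! ### The closed form of the greatest saving and its recursion -/

/-- The greatest saving of a decision tree of size `t` over a constant prediction, for the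
disjunction of two disjoint terms of sizes `a ≤ b`. -/
noncomputable def maxSaving (a b t : ℕ) : ℝ :=
  -- With one literal of the short term missing, the end of the path has bias `2^(-b)` towards `1`.
  -- From `t = a` on, the quotient counts full paths for the long term; the `k`-th one saves
  -- `2^(-k-b)`.
  if t + 1 < a then 0 else if t + 1 = a then (1 / 2) ^ (t + b)
  else (1 / 2) ^ a + (1 / 2) ^ b * (1 - (1 / 2) ^ min a ((t - a) / b))

theorem half_pow_le_half_pow {a b : ℕ} (h : a ≤ b) : ((1 : ℝ) / 2) ^ b ≤ (1 / 2) ^ a :=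
  pow_le_pow_of_le_one (by norm_num) (by norm_num) h

theorem half_pow_le_one (a : ℕ) : ((1 : ℝ) / 2) ^ a ≤ 1 := pow_le_one₀ (by norm_num) (by norm_num)

theorem half_pow_pos (a : ℕ) : (0 : ℝ) < (1 / 2) ^ a := by positivity

theorem maxSaving_of_lt {a b t : ℕ} (h : t + 1 < a) : maxSaving a b t = 0 := if_pos h

theorem maxSaving_of_eq {a b t : ℕ} (h : t + 1 = a) : maxSaving a b t = (1 / 2) ^ (t + b) := by
  rw [maxSaving, if_neg h.not_lt, if_pos h]

theorem maxSaving_of_le {a b t : ℕ} (h : a ≤ t) : maxSaving a b t =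
    (1 / 2) ^ a + (1 / 2) ^ b * (1 - (1 / 2) ^ min a ((t - a) / b)) := by
  rw [maxSaving, if_neg (by omega), if_neg (by omega)]

theorem half_pow_le_maxSaving {a b t : ℕ} (h : a ≤ t) : (1 / 2) ^ a ≤ maxSaving a b t := by
  rw [maxSaving_of_le h]
  have := mul_nonneg (half_pow_pos b).le
    (sub_nonneg.2 (half_pow_le_one (min a ((t - a) / b))))
  linarith

theorem maxSaving_nonneg (a b t : ℕ) : 0 ≤ maxSaving a b t := by
  rcases lt_trichotomy (t + 1) a with h | h | h
  · rw [maxSaving_of_lt h]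
  · rw [maxSaving_of_eq h]; positivity
  · exact (half_pow_pos a).le.trans (half_pow_le_maxSaving (by omega))

theorem maxSaving_zero_left (b t : ℕ) : maxSaving 0 b t = 1 := by
  rw [maxSaving_of_le (Nat.zero_le t)]; simp

theorem maxSaving_mono {a b t t' : ℕ} (hab : a ≤ b) (h : t ≤ t') :
    maxSaving a b t ≤ maxSaving a b t' := by
  rcases lt_trichotomy (t + 1) a with h1 | h1 | h1
  · rw [maxSaving_of_lt h1]; exact maxSaving_nonneg _ _ _
  · rcases h.eq_or_lt with rfl | h2
    · rfl
    · rw [maxSaving_of_eq h1]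
      exact (half_pow_le_half_pow (by omega)).trans (half_pow_le_maxSaving (by omega))
  · rw [maxSaving_of_le (by omega), maxSaving_of_le (by omega)]
    have : ((1 : ℝ) / 2) ^ min a ((t' - a) / b) ≤ (1 / 2) ^ min a ((t - a) / b) :=
      half_pow_le_half_pow (min_le_min_left _ (Nat.div_le_div_right (by omega)))
    nlinarith [half_pow_pos b]

theorem maxSaving_step_short {a b t t' : ℕ} (ha : 1 ≤ a) (hab : a ≤ b) (h : t' + 1 ≤ t) :
    maxSaving (a - 1) b t' / 2 ≤ maxSaving a b t := by
  obtain ⟨a, rfl⟩ := Nat.exists_eq_add_of_le' ha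
  refine le_trans ?_ (maxSaving_mono hab h)
  rw [Nat.add_sub_cancel]
  rcases lt_trichotomy (t' + 1) a with h1 | h1 | h1
  · rw [maxSaving_of_lt h1, maxSaving_of_lt (by omega)]; simp
  · rw [maxSaving_of_eq h1, maxSaving_of_eq (by omega), show t' + 1 + b = t' + b + 1 by ring, pow_succ]
    linarith
  · rw [maxSaving_of_le (by omega), maxSaving_of_le (by omega), Nat.add_sub_add_right, pow_succ]
    have h1 : ((1 : ℝ) / 2) ^ min (a + 1) ((t' - a) / b) ≤ (1 / 2) ^ min a ((t' - a) / b) :=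
      half_pow_le_half_pow (min_le_min_right _ (by omega))
    have h2 := half_pow_le_one (min (a + 1) ((t' - a) / b))
    have h3 := half_pow_pos b
    nlinarith

/-- A new top node with a full negative path raises the number of full paths by exactly one and
moves the old ones down a level. -/
theorem maxSaving_succ_full {a b t : ℕ} (ha : a ≤ t) (hb : 1 ≤ b) :
    maxSaving (a + 1) b (t + b + 1) = (maxSaving a b t + (1 / 2) ^ b) / 2 := by
  rw [maxSaving_of_le (by omega), maxSaving_of_le ha,
    show t + b + 1 - (a + 1) = (t - a) + b by omega, Nat.add_div_right _ hb,
    min_add_add_right]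
  simp only [pow_succ]
  ring

theorem maxSaving_step_full {a b t t' : ℕ} (ha : 1 ≤ a) (hab : a ≤ b) (h : t' + b + 1 ≤ t) :
    (maxSaving (a - 1) b t' + (1 / 2) ^ b) / 2 ≤ maxSaving a b t := by
  obtain ⟨a, rfl⟩ := Nat.exists_eq_add_of_le' ha
  refine le_trans ?_ (maxSaving_mono hab h)
  rw [Nat.add_sub_cancel]
  have key : ((1 : ℝ) / 2) ^ b ≤ (1 / 2) ^ (a + 1) := half_pow_le_half_pow hab
  have hge : (1 / 2) ^ (a + 1) ≤ maxSaving (a + 1) b (t' + b + 1) :=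
    half_pow_le_maxSaving (by omega)
  have := half_pow_pos b
  rcases lt_trichotomy (t' + 1) a with h1 | h1 | h1
  · rw [maxSaving_of_lt h1]; linarith
  · rw [maxSaving_of_eq h1]
    have : ((1 : ℝ) / 2) ^ (t' + b) ≤ (1 / 2) ^ (a + 1) := half_pow_le_half_pow (by omega)
    linarith
  · rw [maxSaving_succ_full (by omega) (by omega)]

theorem maxSaving_step_other_short {a b t t' : ℕ} (hab : a < b) (h : t' + 1 ≤ t) :
    maxSaving a (b - 1) t' / 2 ≤ maxSaving a b t := by
  obtain ⟨b, rfl⟩ := Nat.exists_eq_add_of_le' (show 1 ≤ b by omega)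
  rw [Nat.add_sub_cancel]
  rcases lt_trichotomy (t' + 1) a with h1 | h1 | h1
  · rw [maxSaving_of_lt h1]; simpa using maxSaving_nonneg _ _ _
  · have hge : (1 / 2) ^ a ≤ maxSaving a (b + 1) t := half_pow_le_maxSaving (by omega)
    rw [maxSaving_of_eq h1]
    have : ((1 : ℝ) / 2) ^ (t' + b) ≤ (1 / 2) ^ a := half_pow_le_half_pow (by omega)
    have := half_pow_pos (t' + b)
    linarith
  · have hge : (1 / 2) ^ a ≤ maxSaving a (b + 1) t := half_pow_le_maxSaving (by omega)
    rw [maxSaving_of_le (by omega)]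
    have h1 : ((1 : ℝ) / 2) ^ b ≤ (1 / 2) ^ a := half_pow_le_half_pow (by omega)
    have h2 := half_pow_pos b
    have h3 := half_pow_pos (min a ((t' - a) / b))
    nlinarith

/-- This covers querying the longer term first, with a negative subtree large enough to settle the
shorter one. -/
theorem maxSaving_step_other_full {a b t t' : ℕ} (ha : 1 ≤ a) (hab : a < b)
    (h : t' + a + 1 ≤ t) :
    (maxSaving a (b - 1) t' + (1 / 2) ^ a) / 2 ≤ maxSaving a b t := by
  obtain ⟨b, rfl⟩ := Nat.exists_eq_add_of_le' (show 1 ≤ b by omega)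
  rw [Nat.add_sub_cancel]
  have hge : (1 / 2) ^ a ≤ maxSaving a (b + 1) t := half_pow_le_maxSaving (by omega)
  have hpos := half_pow_pos a
  rcases lt_trichotomy (t' + 1) a with h1 | h1 | h1
  · rw [maxSaving_of_lt h1]; linarith
  · rw [maxSaving_of_eq h1]
    have : ((1 : ℝ) / 2) ^ (t' + b) ≤ (1 / 2) ^ a := half_pow_le_half_pow (by omega)
    linarith
  · rw [maxSaving_of_le (by omega), maxSaving_of_le (by omega)]
    -- The `a` nodes of the negative subtree pay for lengthening each of the at most `a` full paths
    -- by one node.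
    have hj : min a ((t' - a) / b) ≤ min a ((t - a) / (b + 1)) := by
      refine le_min (min_le_left _ _) ((Nat.le_div_iff_mul_le (by omega)).2 ?_)
      have e1 : min a ((t' - a) / b) ≤ a := min_le_left _ _
      have e2 : min a ((t' - a) / b) * b ≤ t' - a :=
        (Nat.mul_le_mul_right b (min_le_right _ _)).trans (Nat.div_mul_le_self _ _)
      rw [Nat.mul_add]
      omega
    have h2 := half_pow_le_half_pow hj
    have h3 := half_pow_pos b
    rw [pow_succ (1 / 2 : ℝ) b]
    nlinarith

/-! ### Decision trees oriented by the literals -/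

namespace DTree

variable {n : ℕ}

/-- The internal node on feature `i` with given children for the literal of `i` (of polarity `s i`)
being false and true. -/
def branch (s : Fin n → Bool) (i : Fin n) (N P : DTree n) : DTree n :=
  if s i then node i N P else node i P N

/-- This removes the polarities from all later inductions: every internal node is a `branch` with a
negative and a positive child. -/
theorem branch_induction (s : Fin n → Bool) {motive : DTree n → Prop} (leaf : motive leaf)
    (branch : ∀ i N P, motive N → motive P → motive (branch s i N P)) (T : DTree n) : motive T := by
  induction T with
  | leaf => exact leaf
  | node i L R hL hR =>
    cases h : s i
    · have := branch i R L hR hL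
      simpa [DTree.branch, h] using this
    · have := branch i L R hL hR
      simpa [DTree.branch, h] using this

/-- The sum over the leaves of `T` of a function of the set of inputs from `A` that reach the
leaf. -/
def leafSum (φ : Finset (Input n) → ℝ) : DTree n → Finset (Input n) → ℝ
  | leaf, A => φ A
  | node i L R, A => L.leafSum φ (A.filter (fun x => x i = false)) +
      R.leafSum φ (A.filter (fun x => x i = true))

section branch

variable (s : Fin n → Bool) (i : Fin n) (N P : DTree n)

theorem size_branch : (branch s i N P).size = N.size + P.size + 1 := by
  unfold branch; split_ifs <;> simp [size]; omega

theorem spine_branch : (branch s i N P).spine s = (i, N) :: P.spine s := by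
  cases h : s i <;> simp [branch, h, spine]

theorem leafSum_branch (φ : Finset (Input n) → ℝ) (A : Finset (Input n)) :
    (branch s i N P).leafSum φ A = N.leafSum φ (A.filter (fun x => x i = !s i)) +
      P.leafSum φ (A.filter (fun x => x i = s i)) := by
  cases h : s i <;> simp [branch, h, leafSum]
  ring

theorem mem_leaves_branch {v : List Bool} : v ∈ (branch s i N P).leaves ↔
    (∃ w ∈ N.leaves, v = (!s i) :: w) ∨ ∃ w ∈ P.leaves, v = s i :: w := by
  cases h : s i <;> simp [branch, h, leaves, eq_comm, or_comm]

theorem split_branch_neg (w : List Bool) (j : Fin n) :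
    (branch s i N P).split ((!s i) :: w) j = branch s i (N.split w j) P := by
  cases h : s i <;> simp [branch, h, split]

theorem split_branch_pos (w : List Bool) (j : Fin n) :
    (branch s i N P).split (s i :: w) j = branch s i N (P.split w j) := by
  cases h : s i <;> simp [branch, h, split]

theorem pathFeatures_branch_neg (w : List Bool) :
    (branch s i N P).pathFeatures ((!s i) :: w) = insert i (N.pathFeatures w) := by
  cases h : s i <;> simp [branch, h, pathFeatures]

theorem pathFeatures_branch_pos (w : List Bool) :
    (branch s i N P).pathFeatures (s i :: w) = insert i (P.pathFeatures w) := by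
  cases h : s i <;> simp [branch, h, pathFeatures]

end branch

/-! ### Sums over leaves -/

/-- The bridge from sums over leaf addresses to a quantity that recurses through the tree together
with the cell. -/
theorem sum_leaves (φ : Finset (Input n) → ℝ) (T : DTree n) (A : Finset (Input n)) :
    ∑ l ∈ T.leaves, φ (A.filter (fun x => T.route x = l)) = T.leafSum φ A := by
  induction T generalizing A with
  | leaf => simp [leaves, leafSum, route]
  | node i L R hL hR =>
    rw [leaves, Finset.sum_union, Finset.sum_image (by simp), Finset.sum_image (by simp), leafSum,
      ← hL, ← hR]
    · congr 1 <;> refine Finset.sum_congr rfl fun l _ => ?_ <;> rw [Finset.filter_filter] <;>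
        congr 1 <;> refine Finset.filter_congr fun x _ => ?_ <;> cases h : x i <;> simp [route, h]
    · rw [Finset.disjoint_left]
      intro v hv hv'
      simp only [Finset.mem_image] at hv hv'
      obtain ⟨_, _, rfl⟩ := hv
      obtain ⟨_, _, h⟩ := hv'
      simp at h

theorem route_mem_leaves (T : DTree n) (x : Input n) : T.route x ∈ T.leaves := by
  induction T with
  | leaf => simp [leaves, route]
  | node i L R hL hR => cases h : x i <;> simp [leaves, route, h, hL, hR]

theorem prefix_route_iff {T : DTree n} {l : List Bool} (hl : l ∈ T.leaves) (x : Input n) :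
    l <+: T.route x ↔ T.route x = l := by
  induction T generalizing l with
  | leaf =>
    simp only [leaves, Finset.mem_singleton] at hl
    subst hl
    simp [route]
  | node i L R hL hR =>
    simp only [leaves, Finset.mem_union, Finset.mem_image] at hl
    rcases hl with ⟨w, hw, rfl⟩ | ⟨w, hw, rfl⟩ <;> cases h : x i <;>
      simp [route, h, List.cons_prefix_cons, hL, hR, hw]

/-- The number of inputs from `A` on which the majority prediction on `A` is wrong. -/
noncomputable def minorCount (f : Input n → Bool) (A : Finset (Input n)) : ℝ :=
  min ((A.filter (fun x => f x = true)).card : ℝ) (A.filter (fun x => ¬ f x = true)).card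

/-- The entropy of `f` on `A`, weighted with the number of inputs in `A`. -/
noncomputable def cellEntropy (f : Input n → Bool) (A : Finset (Input n)) : ℝ :=
  A.card * Real.binEntropy ((A.filter (fun x => f x = true)).card / A.card)

theorem p_eq {T : DTree n} {l : List Bool} (hl : l ∈ T.leaves) :
    T.p l = (Finset.univ.filter (fun x => T.route x = l)).card / 2 ^ n := by
  simp only [p, prob, prefix_route_iff hl]

theorem q_eq (f : Input n → Bool) {T : DTree n} {l : List Bool} (hl : l ∈ T.leaves) :
    T.q f l = ((Finset.univ.filter (fun x => T.route x = l)).filter (fun x => f x = true)).card /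
      (Finset.univ.filter (fun x => T.route x = l)).card := by
  rw [q, p_eq hl]
  simp only [prob, prefix_route_iff hl, Finset.filter_filter]
  rw [div_div_div_cancel_right₀ (by positivity)]

theorem entropy_eq (f : Input n → Bool) (T : DTree n) :
    T.entropy f = T.leafSum (cellEntropy f) Finset.univ / (2 ^ n * Real.log 2) := by
  rw [entropy, ← sum_leaves, Finset.sum_div]
  refine Finset.sum_congr rfl fun l hl => ?_
  rw [p_eq hl, q_eq f hl, cellEntropy]
  ring

theorem card_filter_label_ne (f : Input n → Bool) {T : DTree n} {l : List Bool}
    (hl : l ∈ T.leaves) :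
    ((Finset.univ.filter (fun x => T.route x = l ∧ T.label f l ≠ f x)).card : ℝ) =
      minorCount f (Finset.univ.filter (fun x => T.route x = l)) := by
  rw [← Finset.filter_filter, minorCount, label, q_eq f hl]
  set A := Finset.univ.filter (fun x => T.route x = l)
  have hcard : ((A.filter (fun x => f x = true)).card : ℝ) +
      (A.filter (fun x => ¬ f x = true)).card = A.card := by
    exact_mod_cast Finset.card_filter_add_card_filter_not _
  rcases A.eq_empty_or_nonempty with h | h
  · simp [h]
  · have hpos : (0 : ℝ) < A.card := by exact_mod_cast h.card_pos
    by_cases hq : 1 / 2 ≤ ((A.filter (fun x => f x = true)).card : ℝ) / A.card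
    · have hq' := hq
      rw [le_div_iff₀ hpos] at hq'
      rw [min_eq_right (by linarith)]
      rw [decide_eq_true hq]
      norm_cast
      refine congrArg _ (Finset.filter_congr fun x _ => ?_)
      cases f x <;> simp
    · have hq' := hq
      rw [not_le, div_lt_iff₀ hpos] at hq'
      rw [min_eq_left (by linarith), decide_eq_false hq]
      norm_cast
      refine congrArg _ (Finset.filter_congr fun x _ => ?_)
      cases f x <;> simp

theorem err_eq (f : Input n → Bool) (T : DTree n) :
    T.err f = T.leafSum (minorCount f) Finset.univ / 2 ^ n := by
  rw [err, prob, ← sum_leaves]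
  congr 1
  rw [Finset.card_eq_sum_card_fiberwise (f := T.route) (t := T.leaves)
    (fun x _ => T.route_mem_leaves x)]
  push_cast
  refine Finset.sum_congr rfl fun l hl => ?_
  rw [← card_filter_label_ne f hl, Finset.filter_filter]
  congr 2
  refine Finset.filter_congr fun x _ => ?_
  constructor
  · rintro ⟨h1, rfl⟩; exact ⟨rfl, h1⟩
  · rintro ⟨rfl, h1⟩; exact ⟨h1, rfl⟩

theorem leafSum_split_le {φ : Finset (Input n) → ℝ}
    (hφ : ∀ A (i : Fin n), φ (A.filter (fun x => x i = false)) + φ (A.filter (fun x => x i = true))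
      ≤ φ A) (T : DTree n) (l : List Bool) (i : Fin n) (A : Finset (Input n)) :
    (T.split l i).leafSum φ A ≤ T.leafSum φ A := by
  induction T generalizing l A with
  | leaf => cases l <;> simp [split, leafSum, hφ]
  | node j L R hL hR =>
    rcases l with _ | ⟨_ | _, l⟩ <;> simp [split, leafSum, hL, hR]

theorem card_filter_and_split (A : Finset (Input n)) (i : Fin n) (p : Input n → Prop)
    [DecidablePred p] :
    (((A.filter (fun x => x i = false)).filter p).card : ℝ) +
      ((A.filter (fun x => x i = true)).filter p).card = (A.filter p).card := by
  rw [Finset.filter_comm (fun x : Input n => x i = false),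
    Finset.filter_comm (fun x : Input n => x i = true)]
  have := Finset.card_filter_add_card_filter_not (s := A.filter p) (fun x => x i = false)
  simp only [Bool.not_eq_false] at this
  exact_mod_cast this

theorem minorCount_add_le (f : Input n → Bool) (A : Finset (Input n)) (i : Fin n) :
    minorCount f (A.filter (fun x => x i = false)) + minorCount f (A.filter (fun x => x i = true))
      ≤ minorCount f A := by
  unfold minorCount
  rw [← card_filter_and_split A i, ← card_filter_and_split A i]
  refine le_min ?_ ?_ <;> gcongr
  · exact min_le_left _ _
  · exact min_le_left _ _
  · exact min_le_right _ _
  · exact min_le_right _ _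

theorem err_split_le (f : Input n → Bool) (T : DTree n) (l : List Bool) (i : Fin n) :
    (T.split l i).err f ≤ T.err f := by
  rw [err_eq, err_eq]
  gcongr
  exact leafSum_split_le (minorCount_add_le f) _ _ _ _

theorem err_nonneg (f : Input n → Bool) (T : DTree n) : 0 ≤ T.err f := by
  unfold err prob; positivity

theorem size_split_le (T : DTree n) (l : List Bool) (i : Fin n) :
    (T.split l i).size ≤ T.size + 1 := by
  induction T generalizing l with
  | leaf => cases l <;> simp [split, size]
  | node j L R hL hR =>
    rcases l with _ | ⟨_ | _, l⟩ <;> simp [split, size]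
    · have := hL l; omega
    · have := hR l; omega

theorem exists_isTopDownStep (f : Input n → Bool) (T : DTree n) : ∃ T', IsTopDownStep f T T' := by
  classical
  by_cases h : ∀ l ∈ T.leaves, ∀ i, i ∈ T.pathFeatures l
  · exact ⟨T, Or.inr ⟨h, rfl⟩⟩
  · push Not at h
    obtain ⟨l, hl, i, hi⟩ := h
    obtain ⟨⟨l, i⟩, hm, hmax⟩ := Finset.exists_max_image
      ((T.leaves ×ˢ (Finset.univ : Finset (Fin n))).filter (fun e => e.2 ∉ T.pathFeatures e.1))
      (fun e => T.gain f e.1 e.2) ⟨(l, i), by simp [hl, hi]⟩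
    simp only [Finset.mem_filter, Finset.mem_product, Finset.mem_univ, and_true] at hm
    refine ⟨_, Or.inl ⟨l, hm.1, i, hm.2, fun l' hl' i' hi' => hmax (l', i') ?_, rfl⟩⟩
    simp [hl', hi']

theorem exists_isTopDownRun (f : Input n → Bool) : ∃ T : ℕ → DTree n, IsTopDownRun f T := by
  choose g hg using exists_isTopDownStep (n := n) f
  exact ⟨fun t => Nat.rec leaf (fun _ T => g T) t, rfl, fun t => hg _⟩

theorem IsTopDownStep.size_le {f : Input n → Bool} {T T' : DTree n} (h : IsTopDownStep f T T') :
    T'.size ≤ T.size + 1 := by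
  rcases h with ⟨l, _, i, _, _, rfl⟩ | ⟨_, rfl⟩
  · exact size_split_le _ _ _
  · omega

theorem IsTopDownStep.err_le {f : Input n → Bool} {T T' : DTree n} (h : IsTopDownStep f T T') :
    T'.err f ≤ T.err f := by
  rcases h with ⟨l, _, i, _, _, rfl⟩ | ⟨_, rfl⟩
  · exact err_split_le _ _ _ _
  · exact le_rfl

theorem IsTopDownRun.size_le {f : Input n → Bool} {T : ℕ → DTree n} (h : IsTopDownRun f T) (t : ℕ) :
    (T t).size ≤ t := by
  induction t with
  | zero => rw [h.1]; simp [size]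
  | succ t ih => exact (h.2 t).size_le.trans (by omega)

theorem IsTopDownRun.err_antitone {f : Input n → Bool} {T : ℕ → DTree n} (h : IsTopDownRun f T) :
    Antitone (fun t => (T t).err f) :=
  antitone_nat_of_succ_le fun t => (h.2 t).err_le

/-- The decrease of the weighted entropy on `A`, when the leaf `l` is split on `i`. -/
noncomputable def gainOn (f : Input n → Bool) (T : DTree n) (A : Finset (Input n)) (l : List Bool)
    (i : Fin n) : ℝ :=
  T.leafSum (cellEntropy f) A - (T.split l i).leafSum (cellEntropy f) A

theorem gain_eq (f : Input n → Bool) (T : DTree n) (l : List Bool) (i : Fin n) :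
    T.gain f l i = T.gainOn f Finset.univ l i / (2 ^ n * Real.log 2) := by
  rw [gain, entropy_eq, entropy_eq, gainOn, sub_div]

theorem gain_le_gain_iff (f : Input n → Bool) (T : DTree n) (l l' : List Bool) (i i' : Fin n) :
    T.gain f l i ≤ T.gain f l' i' ↔ T.gainOn f Finset.univ l i ≤ T.gainOn f Finset.univ l' i' := by
  have : 0 < Real.log 2 := Real.log_pos (by norm_num)
  rw [gain_eq, gain_eq, div_le_div_iff_of_pos_right (by positivity)]

theorem gainOn_branch_neg (f : Input n → Bool) (s : Fin n → Bool) (j : Fin n) (N P : DTree n)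
    (A : Finset (Input n)) (w : List Bool) (i : Fin n) :
    (branch s j N P).gainOn f A ((!s j) :: w) i =
      N.gainOn f (A.filter (fun x => x j = !s j)) w i := by
  simp only [gainOn, split_branch_neg, leafSum_branch]; ring

theorem gainOn_branch_pos (f : Input n → Bool) (s : Fin n → Bool) (j : Fin n) (N P : DTree n)
    (A : Finset (Input n)) (w : List Bool) (i : Fin n) :
    (branch s j N P).gainOn f A (s j :: w) i =
      P.gainOn f (A.filter (fun x => x j = s j)) w i := by
  simp only [gainOn, split_branch_pos, leafSum_branch]; ring

theorem gainOn_leaf (f : Input n → Bool) (s : Fin n → Bool) (A : Finset (Input n)) (i : Fin n) :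
    leaf.gainOn f A [] i = cellEntropy f A - cellEntropy f (A.filter (fun x => x i = !s i)) -
      cellEntropy f (A.filter (fun x => x i = s i)) := by
  cases h : s i <;> simp [gainOn, split, leafSum] <;> ring

end DTree

/-! ### Subcubes and the status of the two terms on them -/

open DTree

variable {n : ℕ}

/-- The probability of a term with `a` unset literals: `α` tells whether none of its literals is
already false. -/
noncomputable def termProb (α : Bool) (a : ℕ) : ℝ := if α then (1 / 2) ^ a else 0

@[simp] theorem termProb_true (a : ℕ) : termProb true a = (1 / 2) ^ a := rfl

@[simp] theorem termProb_false (a : ℕ) : termProb false a = 0 := rfl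

theorem card_subcube (D : Finset (Fin n)) (c : Input n) :
    ((Finset.univ.filter (fun x : Input n => ∀ i ∈ D, x i = c i)).card : ℝ) =
      2 ^ n * (1 / 2) ^ D.card := by
  have e : Finset.univ.filter (fun x : Input n => ∀ i ∈ D, x i = c i) =
      Fintype.piFinset (fun i => if i ∈ D then {c i} else Finset.univ) := by
    ext x
    simp only [Finset.mem_filter, Finset.mem_univ, true_and, Fintype.mem_piFinset]
    refine forall_congr' fun i => ?_
    by_cases h : i ∈ D <;> simp [h]
  have h1 : ∀ i, (if i ∈ D then {c i} else (Finset.univ : Finset Bool)).card =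
      if i ∈ D then 1 else 2 := by
    intro i; split_ifs <;> simp
  have h2 : (2 : ℝ) ^ n = 2 ^ D.card * 2 ^ Dᶜ.card := by
    rw [← pow_add, Finset.card_add_card_compl, Fintype.card_fin]
  rw [e, Fintype.card_piFinset]
  simp only [h1]
  rw [Finset.prod_ite]
  simp only [Finset.prod_const, one_pow, one_mul]
  rw [show Finset.univ.filter (fun i => i ∉ D) = Dᶜ by ext; simp]
  rw [h2, mul_right_comm, ← mul_pow]
  norm_num

theorem card_subcube_filter (s c : Input n) (D Z : Finset (Fin n)) (γ : Bool)
    (hγ : γ = true ↔ ∀ i ∈ Z ∩ D, c i = s i) :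
    (((Finset.univ.filter (fun x : Input n => ∀ i ∈ D, x i = c i)).filter
      (fun x => ∀ i ∈ Z, x i = s i)).card : ℝ) =
      2 ^ n * (1 / 2) ^ D.card * termProb γ (Z \ D).card := by
  rw [Finset.filter_filter]
  cases γ
  · simp only [Bool.false_eq_true, false_iff, not_forall] at hγ
    obtain ⟨i, hi, hc⟩ := hγ
    rw [Finset.mem_inter] at hi
    rw [Finset.filter_eq_empty_iff.2]
    · simp
    · rintro x - ⟨h1, h2⟩
      exact hc (by rw [← h1 i hi.2, h2 i hi.1])
  · have hγ' := hγ.1 rfl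
    have := card_subcube (D ∪ Z) (fun i => if i ∈ D then c i else s i)
    rw [termProb_true, mul_assoc, ← pow_add, add_comm, Finset.card_sdiff_add_card, Finset.union_comm,
      ← this]
    congr 2
    ext x
    simp only [Finset.mem_filter, Finset.mem_univ, true_and, Finset.mem_union]
    constructor
    · rintro ⟨h1, h2⟩ i hi
      by_cases h : i ∈ D
      · simp [h, h1 i h]
      · simp [h, h2 i (hi.resolve_left h)]
    · intro h
      refine ⟨fun i hi => by simpa [hi] using h i (Or.inl hi), fun i hi => ?_⟩
      have h3 := h i (Or.inr hi)
      by_cases h4 : i ∈ D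
      · rw [h3, if_pos h4]; exact hγ' i (Finset.mem_inter.2 ⟨hi, h4⟩)
      · rw [h3, if_neg h4]

theorem twoTermDNF_eq_true (s : Fin n → Bool) (X Y : Finset (Fin n)) (x : Input n) :
    twoTermDNF s X Y x = true ↔ (∀ i ∈ X, x i = s i) ∨ ∀ i ∈ Y, x i = s i := by
  simp [twoTermDNF]

theorem twoTermDNF_comm (s : Fin n → Bool) (X Y : Finset (Fin n)) :
    twoTermDNF s X Y = twoTermDNF s Y X := by
  funext x; exact Bool.or_comm _ _

/-- `A` is the set of inputs with certain values of the features in `D`; `α` and `β` tell whether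
these values leave the terms on `X` and on `Y` satisfiable. -/
def IsCell (s : Fin n → Bool) (X Y D : Finset (Fin n)) (α β : Bool) (A : Finset (Input n)) : Prop :=
  ∃ c : Input n, A = Finset.univ.filter (fun x => ∀ i ∈ D, x i = c i) ∧
    (α = true ↔ ∀ i ∈ X ∩ D, c i = s i) ∧ (β = true ↔ ∀ i ∈ Y ∩ D, c i = s i)

theorem isCell_univ (s : Fin n → Bool) (X Y : Finset (Fin n)) :
    IsCell s X Y ∅ true true Finset.univ :=
  ⟨s, by simp, by simp, by simp⟩

namespace IsCell

variable {s : Fin n → Bool} {X Y D : Finset (Fin n)} {α β : Bool} {A : Finset (Input n)}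

theorem card (h : IsCell s X Y D α β A) : (A.card : ℝ) = 2 ^ n * (1 / 2) ^ D.card := by
  obtain ⟨c, rfl, -, -⟩ := h
  exact card_subcube D c

theorem card_pos (h : IsCell s X Y D α β A) : (0 : ℝ) < A.card := by
  rw [h.card]; positivity

theorem card_true (hXY : Disjoint X Y) (h : IsCell s X Y D α β A) :
    ((A.filter (fun x => twoTermDNF s X Y x = true)).card : ℝ) =
      A.card * orProb (termProb α (X \ D).card) (termProb β (Y \ D).card) := by
  rw [h.card]
  obtain ⟨c, rfl, hα, hβ⟩ := h
  simp only [twoTermDNF_eq_true]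
  rw [Finset.filter_or]
  set A := Finset.univ.filter (fun x : Input n => ∀ i ∈ D, x i = c i) with hA
  have e1 := card_subcube_filter s c D X α hα
  have e2 := card_subcube_filter s c D Y β hβ
  -- Inclusion-exclusion: both terms hold exactly when the joint term on `X ∪ Y` does, and
  -- disjointness makes its probability a product.
  have e3 := card_subcube_filter s c D (X ∪ Y) (α && β) (by
    rw [Bool.and_eq_true, hα, hβ]
    simp only [Finset.mem_inter, Finset.mem_union]
    grind)
  have e4 : A.filter (fun x => ∀ i ∈ X ∪ Y, x i = s i) =
      A.filter (fun x => ∀ i ∈ X, x i = s i) ∩ A.filter (fun x => ∀ i ∈ Y, x i = s i) := by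
    rw [← Finset.filter_and]
    refine Finset.filter_congr fun x _ => ?_
    simp only [Finset.mem_union]
    grind
  have e5 : ((X ∪ Y) \ D).card = (X \ D).card + (Y \ D).card := by
    rw [Finset.union_sdiff_distrib, Finset.card_union_of_disjoint]
    exact hXY.mono Finset.sdiff_subset Finset.sdiff_subset
  have e6 : termProb (α && β) ((X \ D).card + (Y \ D).card) =
      termProb α (X \ D).card * termProb β (Y \ D).card := by
    cases α <;> cases β <;> simp [pow_add]
  rw [e4, e5, e6] at e3
  have := Finset.card_union_add_card_inter (A.filter (fun x => ∀ i ∈ X, x i = s i))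
    (A.filter (fun x => ∀ i ∈ Y, x i = s i))
  have h' := congrArg (Nat.cast (R := ℝ)) this
  push_cast at h'
  rw [e1, e2, e3] at h'
  rw [orProb]
  linarith

theorem filter (h : IsCell s X Y D α β A) {i : Fin n} (hi : i ∉ D) (b : Bool) {α' β' : Bool}
    (hα : α' = true ↔ α = true ∧ (i ∈ X → b = s i))
    (hβ : β' = true ↔ β = true ∧ (i ∈ Y → b = s i)) :
    IsCell s X Y (insert i D) α' β' (A.filter (fun x => x i = b)) := by
  obtain ⟨c, rfl, h1, h2⟩ := h
  have hc : ∀ Z : Finset (Fin n), (∀ j ∈ Z ∩ insert i D, Function.update c i b j = s j) ↔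
      (∀ j ∈ Z ∩ D, c j = s j) ∧ (i ∈ Z → b = s i) := by
    intro Z
    simp only [Finset.mem_inter, Finset.mem_insert]
    constructor
    · intro H
      refine ⟨fun j hj => ?_, fun hZ => by simpa using H i ⟨hZ, Or.inl rfl⟩⟩
      have hne : j ≠ i := fun e => hi (e ▸ hj.2)
      simpa [hne] using H j ⟨hj.1, Or.inr hj.2⟩
    · rintro ⟨H1, H2⟩ j ⟨hj, rfl | hj'⟩
      · simpa using H2 hj
      · have hne : j ≠ i := fun e => hi (e ▸ hj')
        simpa [hne] using H1 j ⟨hj, hj'⟩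
  refine ⟨Function.update c i b, ?_, by rw [hα, h1, hc], by rw [hβ, h2, hc]⟩
  rw [Finset.filter_filter]
  refine Finset.filter_congr fun x _ => ?_
  rw [Finset.forall_mem_insert, and_comm]
  refine and_congr (by simp) (forall₂_congr fun j hj => ?_)
  have hne : j ≠ i := fun e => hi (e ▸ hj)
  simp [hne]

theorem filter_pos (h : IsCell s X Y D α β A) {i : Fin n} (hi : i ∉ D) :
    IsCell s X Y (insert i D) α β (A.filter (fun x => x i = s i)) :=
  h.filter hi _ (by simp) (by simp)

theorem filter_neg_left (hXY : Disjoint X Y) (h : IsCell s X Y D α β A) {i : Fin n} (hi : i ∉ D)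
    (hX : i ∈ X) : IsCell s X Y (insert i D) false β (A.filter (fun x => x i = !s i)) :=
  h.filter hi _ (by simp [hX]) (by simp [Finset.disjoint_left.1 hXY hX])

theorem filter_neg_right (hXY : Disjoint X Y) (h : IsCell s X Y D α β A) {i : Fin n} (hi : i ∉ D)
    (hY : i ∈ Y) : IsCell s X Y (insert i D) α false (A.filter (fun x => x i = !s i)) :=
  h.filter hi _ (by simp [Finset.disjoint_right.1 hXY hY]) (by simp [hY])

theorem filter_other (h : IsCell s X Y D α β A) {i : Fin n} (hi : i ∉ D) (hX : i ∉ X) (hY : i ∉ Y)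
    (b : Bool) : IsCell s X Y (insert i D) α β (A.filter (fun x => x i = b)) :=
  h.filter hi _ (by simp [hX]) (by simp [hY])

/-- Competing trees may query a feature twice on a path; the second query then sends the whole cell
to one child. -/
theorem filter_eq_empty_or (h : IsCell s X Y D α β A) {i : Fin n} (hi : i ∈ D) :
    ∃ b : Bool, A.filter (fun x => x i = b) = A ∧ A.filter (fun x => x i = !b) = ∅ := by
  obtain ⟨c, rfl, -, -⟩ := h
  refine ⟨c i, Finset.filter_true_of_mem fun x hx => (Finset.mem_filter.1 hx).2 i hi,
    Finset.filter_eq_empty_iff.2 fun x hx => ?_⟩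
  rw [(Finset.mem_filter.1 hx).2 i hi]
  simp

theorem comm (h : IsCell s X Y D α β A) : IsCell s Y X D β α A := by
  obtain ⟨c, h1, h2, h3⟩ := h
  exact ⟨c, h1, h3, h2⟩

theorem cellEntropy (hXY : Disjoint X Y) (h : IsCell s X Y D α β A) :
    cellEntropy (twoTermDNF s X Y) A = A.card *
      Real.binEntropy (orProb (termProb α (X \ D).card) (termProb β (Y \ D).card)) := by
  rw [DTree.cellEntropy, h.card_true hXY, mul_div_cancel_left₀ _ h.card_pos.ne']

end IsCell

theorem card_sdiff_insert_add_one {Z D : Finset (Fin n)} {i : Fin n} (h : i ∈ Z) (hD : i ∉ D) :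
    (Z \ insert i D).card + 1 = (Z \ D).card := by
  rw [Finset.sdiff_insert, Finset.card_erase_add_one (Finset.mem_sdiff.2 ⟨h, hD⟩)]

/-! ### The greatest saving -/

/-- The greatest saving of a tree of size `t` for a single term with `a` literals. -/
noncomputable def termSaving (a t : ℕ) : ℝ := if a ≤ t then (1 / 2) ^ a else 0

theorem termSaving_le_one (a t : ℕ) : termSaving a t ≤ 1 := by
  unfold termSaving; split_ifs
  · exact half_pow_le_one a
  · norm_num

theorem termSaving_mono {a t t' : ℕ} (h : t ≤ t') : termSaving a t ≤ termSaving a t' := by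
  unfold termSaving
  split_ifs
  · rfl
  · omega
  · positivity
  · rfl

theorem termSaving_succ (a t : ℕ) : termSaving (a + 1) (t + 1) = termSaving a t / 2 := by
  unfold termSaving
  simp only [Nat.add_le_add_iff_right, pow_succ]
  split_ifs <;> ring

/-- The greatest saving of a tree of size `t` for two terms with `a` and `b` unset literals; `α` and
`β` tell whether none of their literals is already false. -/
noncomputable def stateSaving : Bool → ℕ → Bool → ℕ → ℕ → ℝ
  | true, a, true, b, t => maxSaving (min a b) (max a b) t
  | true, a, false, _, t => termSaving a t
  | false, _, true, b, t => termSaving b t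
  | false, _, false, _, _ => 0

theorem stateSaving_comm (α β : Bool) (a b t : ℕ) :
    stateSaving α a β b t = stateSaving β b α a t := by
  cases α <;> cases β <;> simp [stateSaving, min_comm, max_comm]

theorem stateSaving_mono (α β : Bool) (a b : ℕ) {t t' : ℕ} (h : t ≤ t') :
    stateSaving α a β b t ≤ stateSaving α a β b t' := by
  cases α <;> cases β <;> simp only [stateSaving, le_refl]
  · exact termSaving_mono h
  · exact termSaving_mono h
  · exact maxSaving_mono (by simp) h

/-- The Bellman inequality for querying a literal of the first term: `t'` nodes go to the child
where it is true, `t''` to the child where the term dies. With both terms alive, the cases are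
whether this term is the shorter one and whether `t''` suffices for the other. -/
theorem stateSaving_step (α β : Bool) {a a' b t t' t'' : ℕ} (ha : a' + 1 = a)
    (h : t' + t'' + 1 ≤ t) :
    (stateSaving α a' β b t' + stateSaving false a' β b t'') / 2 ≤ stateSaving α a β b t := by
  subst ha
  cases α <;> cases β <;> simp only [stateSaving]
  · norm_num
  · have h1 : termSaving b t' ≤ termSaving b t := termSaving_mono (by omega)
    have h2 : termSaving b t'' ≤ termSaving b t := termSaving_mono (by omega)
    linarith
  · rw [add_zero, ← termSaving_succ]
    exact termSaving_mono (by omega)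
  · rcases Nat.eq_zero_or_pos b with rfl | hb
    · rw [min_eq_right (Nat.zero_le _), min_eq_right (Nat.zero_le _), maxSaving_zero_left,
        maxSaving_zero_left]
      have := termSaving_le_one 0 t''
      linarith
    · rcases le_or_gt (a' + 1) b with hab | hab
      · rw [min_eq_left hab, max_eq_right hab, min_eq_left (by omega), max_eq_right (by omega)]
        unfold termSaving
        split_ifs with hb'
        · exact maxSaving_step_full (a := a' + 1) (by omega) hab (by omega)
        · rw [add_zero]
          exact maxSaving_step_short (a := a' + 1) (by omega) hab (by omega)
      · rw [min_eq_right (by omega), max_eq_left (by omega), min_eq_right (by omega),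
          max_eq_left (by omega)]
        unfold termSaving
        split_ifs with hb'
        · exact maxSaving_step_other_full (b := a' + 1) hb hab (by omega)
        · rw [add_zero]
          exact maxSaving_step_other_short (b := a' + 1) hab (by omega)

theorem max_zero_orProb (a b : ℕ) (hab : a ≤ b) :
    max 0 (2 * orProb ((1 / 2) ^ a) ((1 / 2) ^ b) - 1) = maxSaving a b 0 := by
  have hb := half_pow_pos b
  rcases a with _ | _ | a
  · rw [maxSaving_zero_left]
    norm_num [orProb]
  · rw [maxSaving_of_eq rfl, max_eq_right] <;> unfold orProb <;> norm_num
    · ring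
    · linarith
  · rw [maxSaving_of_lt (by omega), max_eq_left]
    have h1 : ((1 : ℝ) / 2) ^ (a + 1 + 1) ≤ (1 / 2) ^ 2 := half_pow_le_half_pow (by omega)
    have h2 : ((1 : ℝ) / 2) ^ b ≤ (1 / 2) ^ 2 := half_pow_le_half_pow (by omega)
    unfold orProb
    nlinarith

theorem max_zero_orProb_zero (a : ℕ) :
    max 0 (2 * orProb ((1 / 2) ^ a) 0 - 1) = termSaving a 0 := by
  unfold orProb termSaving
  rcases a with _ | a
  · norm_num
  · have h1 : ((1 : ℝ) / 2) ^ (a + 1) ≤ (1 / 2) ^ 1 := half_pow_le_half_pow (by omega)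
    rw [if_neg (by omega), max_eq_left]
    linarith

theorem max_zero_orProb_termProb (α β : Bool) (a b : ℕ) :
    max 0 (2 * orProb (termProb α a) (termProb β b) - 1) = stateSaving α a β b 0 := by
  have hc : ∀ u w : ℝ, orProb u w = orProb w u := fun u w => by unfold orProb; ring
  cases α <;> cases β <;> simp only [stateSaving, termProb_true, termProb_false]
  · norm_num [orProb]
  · rw [hc, max_zero_orProb_zero]
  · exact max_zero_orProb_zero a
  · rcases le_total a b with h | h
    · rw [min_eq_left h, max_eq_right h, max_zero_orProb a b h]
    · rw [min_eq_right h, max_eq_left h, hc, max_zero_orProb b a h]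

/-! ### Savings of trees -/

/-- The number of errors on `A` that a majority prediction saves over the prediction `false`. -/
noncomputable def saving (f : Input n → Bool) (A : Finset (Input n)) : ℝ :=
  max 0 ((A.filter (fun x => f x = true)).card - (A.filter (fun x => ¬ f x = true)).card : ℝ)

theorem saving_add_minorCount (f : Input n → Bool) (A : Finset (Input n)) :
    saving f A + minorCount f A = (A.filter (fun x => f x = true)).card := by
  unfold saving minorCount
  rcases le_total ((A.filter (fun x => f x = true)).card : ℝ)
    (A.filter (fun x => ¬ f x = true)).card with h | h
  · rw [min_eq_left h, max_eq_left (by linarith)]; ring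
  · rw [min_eq_right h, max_eq_right (by linarith)]; ring

theorem leafSum_saving_add (f : Input n → Bool) (T : DTree n) (A : Finset (Input n)) :
    T.leafSum (saving f) A + T.leafSum (minorCount f) A =
      (A.filter (fun x => f x = true)).card := by
  induction T generalizing A with
  | leaf => exact saving_add_minorCount f A
  | node i L R hL hR =>
    rw [leafSum, leafSum, ← card_filter_and_split A i, ← hL, ← hR]
    ring

theorem leafSum_empty {φ : Finset (Input n) → ℝ} (hφ : φ ∅ = 0) (T : DTree n) :
    T.leafSum φ ∅ = 0 := by
  induction T with
  | leaf => exact hφ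
  | node i L R hL hR => simp [leafSum, hL, hR]

theorem saving_empty (f : Input n → Bool) : saving f ∅ = 0 := by simp [saving]

namespace IsCell

variable {s : Fin n → Bool} {X Y D : Finset (Fin n)} {α β : Bool} {A : Finset (Input n)}

theorem saving_eq (hXY : Disjoint X Y) (h : IsCell s X Y D α β A) :
    saving (twoTermDNF s X Y) A =
      A.card * stateSaving α (X \ D).card β (Y \ D).card 0 := by
  have h1 : ((A.filter (fun x => twoTermDNF s X Y x = true)).card : ℝ) +
      (A.filter (fun x => ¬ twoTermDNF s X Y x = true)).card = A.card := by
    exact_mod_cast Finset.card_filter_add_card_filter_not _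
  have h2 := h.card_true hXY
  rw [← max_zero_orProb_termProb, mul_max_of_nonneg _ _ h.card_pos.le, mul_zero, saving]
  congr 1
  linarith

theorem card_insert (h : IsCell s X Y D α β A) {i : Fin n} (hi : i ∉ D) {α' β' : Bool}
    {B : Finset (Input n)} (h' : IsCell s X Y (insert i D) α' β' B) :
    (B.card : ℝ) = A.card / 2 := by
  rw [h.card, h'.card, Finset.card_insert_of_notMem hi, pow_succ]
  ring

/-- Each query is a repetition, a literal of one term, or irrelevant. Repeated and irrelevant
queries only waste nodes; the others are `stateSaving_step`, with the terms exchanged for `Y`. -/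
theorem leafSum_saving_le (hXY : Disjoint X Y) (T : DTree n) (h : IsCell s X Y D α β A) :
    T.leafSum (saving (twoTermDNF s X Y)) A ≤
      A.card * stateSaving α (X \ D).card β (Y \ D).card T.size := by
  induction T using branch_induction s generalizing D α β A with
  | leaf => exact (h.saving_eq hXY).le
  | branch i N P hN hP =>
    rw [leafSum_branch, size_branch]
    have hA := h.card_pos
    by_cases hi : i ∈ D
    · obtain ⟨b, h1, h2⟩ := h.filter_eq_empty_or hi
      rcases eq_or_ne b (s i) with rfl | hb
      · rw [h1, h2, leafSum_empty (saving_empty _), zero_add]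
        refine (hP h).trans (mul_le_mul_of_nonneg_left (stateSaving_mono _ _ _ _ (by omega)) hA.le)
      · have hb' : b = !s i := by cases b <;> cases hs : s i <;> simp_all
        subst hb'
        rw [Bool.not_not] at h2
        rw [h1, h2, leafSum_empty (saving_empty _), add_zero]
        refine (hN h).trans (mul_le_mul_of_nonneg_left (stateSaving_mono _ _ _ _ (by omega)) hA.le)
    · have hp := h.filter_pos hi
      have hP' := hP hp
      rw [h.card_insert hi hp] at hP'
      by_cases hX : i ∈ X
      · have hn := h.filter_neg_left hXY hi hX
        have hN' := hN hn
        have hY : i ∉ Y := Finset.disjoint_left.1 hXY hX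
        have hc := card_sdiff_insert_add_one hX hi
        rw [h.card_insert hi hn, Finset.sdiff_insert_of_notMem hY] at hN'
        rw [Finset.sdiff_insert_of_notMem hY] at hP'
        have := mul_le_mul_of_nonneg_left (stateSaving_step α β (b := (Y \ D).card) hc
          (show P.size + N.size + 1 ≤ N.size + P.size + 1 by omega)) hA.le
        linarith
      · by_cases hY : i ∈ Y
        · have hn := h.filter_neg_right hXY hi hY
          have hN' := hN hn
          have hc := card_sdiff_insert_add_one hY hi
          rw [h.card_insert hi hn, Finset.sdiff_insert_of_notMem hX, stateSaving_comm] at hN'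
          rw [Finset.sdiff_insert_of_notMem hX, stateSaving_comm] at hP'
          rw [stateSaving_comm]
          have := mul_le_mul_of_nonneg_left (stateSaving_step β α (b := (X \ D).card) hc
            (show P.size + N.size + 1 ≤ N.size + P.size + 1 by omega)) hA.le
          linarith
        · have hn := h.filter_other hi hX hY (!s i)
          have hN' := hN hn
          rw [h.card_insert hi hn, Finset.sdiff_insert_of_notMem hX,
            Finset.sdiff_insert_of_notMem hY] at hN'
          rw [Finset.sdiff_insert_of_notMem hX, Finset.sdiff_insert_of_notMem hY] at hP'
          have h1 := mul_le_mul_of_nonneg_left (stateSaving_mono α β (X \ D).card (Y \ D).card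
            (show N.size ≤ N.size + P.size + 1 by omega)) hA.le
          have h2 := mul_le_mul_of_nonneg_left (stateSaving_mono α β (X \ D).card (Y \ D).card
            (show P.size ≤ N.size + P.size + 1 by omega)) hA.le
          linarith

end IsCell

/-! ### The trees `B_t` -/

namespace DTree

variable {s : Fin n → Bool} {X Y Z D : Finset (Fin n)} {α β : Bool} {A : Finset (Input n)}

theorem isRightPath_leaf : IsRightPath s Z leaf := by simp [IsRightPath, spine]

theorem isRightPath_branch {i : Fin n} {N P : DTree n} : IsRightPath s Z (branch s i N P) ↔
    i ∈ Z ∧ N = leaf ∧ IsRightPath s (Z.erase i) P := by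
  simp only [IsRightPath, spine_branch, List.forall_mem_cons, List.map_cons, List.nodup_cons,
    List.mem_map, Finset.mem_erase]
  grind

theorem IsRightPath.size_le {T : DTree n} (h : IsRightPath s Z T) : T.size ≤ Z.card := by
  induction T using branch_induction s generalizing Z with
  | leaf => simp [size]
  | branch i N P hN hP =>
    obtain ⟨hi, rfl, h'⟩ := isRightPath_branch.1 h
    have := hP h'
    have := Finset.card_erase_add_one hi
    rw [size_branch, size]
    omega

/-- A tree whose main path has all the features in `X`, with `Y`-paths hanging off it that are
filled from top to bottom. -/
inductive IsFilled (s : Fin n → Bool) (Y : Finset (Fin n)) : Finset (Fin n) → DTree n → Prop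
  | leaf : IsFilled s Y ∅ leaf
  | branch {X : Finset (Fin n)} {i : Fin n} {N P : DTree n} (hi : i ∈ X) (hN : IsRightPath s Y N)
      -- The first alternative says that `P` is a bare path, as `P` has at least `|X| - 1` nodes
      -- anyway.
      (hP : IsFilled s Y (X.erase i) P) (h : P.size + 1 = X.card ∨ N.size = Y.card) :
      IsFilled s Y X (branch s i N P)

theorem IsFilled.card_le {T : DTree n} (h : IsFilled s Y X T) : X.card ≤ T.size := by
  induction h with
  | leaf => simp
  | branch hi hN hP h ih =>
    have := Finset.card_erase_add_one hi
    rw [size_branch]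
    omega

theorem IsRightPath.isFilled {T : DTree n} (h : IsRightPath s X T) (hT : T.size = X.card) :
    IsFilled s Y X T := by
  induction T using branch_induction s generalizing X with
  | leaf =>
    rw [size, eq_comm, Finset.card_eq_zero] at hT
    subst hT
    exact .leaf
  | branch i N P hN hP =>
    obtain ⟨hi, rfl, h'⟩ := isRightPath_branch.1 h
    have := Finset.card_erase_add_one hi
    rw [size_branch, size] at hT
    exact .branch hi isRightPath_leaf (hP h' (by omega)) (Or.inl (by omega))

theorem IsFilled.mem_spine {T : DTree n} (h : IsFilled s Y X T) :
    ∀ e ∈ T.spine s, e.1 ∈ X ∧ IsRightPath s Y e.2 := by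
  induction h with
  | leaf => simp [spine]
  | branch hi hN hP h ih =>
    rw [spine_branch]
    simp only [List.forall_mem_cons]
    exact ⟨⟨hi, hN⟩, fun e he => ⟨Finset.mem_of_mem_erase (ih e he).1, (ih e he).2⟩⟩

theorem IsFilled.length_spine {T : DTree n} (h : IsFilled s Y X T) :
    (T.spine s).length = X.card := by
  induction h with
  | leaf => simp [spine]
  | branch hi hN hP h ih =>
    rw [spine_branch, List.length_cons, ih, Finset.card_erase_add_one hi]

theorem IsFilled.nodup_spine {T : DTree n} (h : IsFilled s Y X T) :
    ((T.spine s).map Prod.fst).Nodup := by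
  induction h with
  | leaf => simp [spine]
  | branch hi hN hP h ih =>
    rw [spine_branch, List.map_cons, List.nodup_cons, List.mem_map]
    refine ⟨?_, ih⟩
    rintro ⟨e, he, rfl⟩
    exact Finset.notMem_erase _ _ (hP.mem_spine e he).1

theorem size_eq_zero {T : DTree n} : T.size = 0 ↔ T = leaf := by
  cases T <;> simp [size]

theorem IsFilled.eq_leaf_of_size_eq {T : DTree n} (h : IsFilled s Y X T) (hT : T.size = X.card) :
    ∀ e ∈ T.spine s, e.2 = DTree.leaf := by
  induction h with
  | leaf => simp [spine]
  | branch hi hN hP h ih =>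
    have h1 := Finset.card_erase_add_one hi
    have h2 := hP.card_le
    rw [size_branch] at hT
    rw [spine_branch]
    simp only [List.forall_mem_cons]
    exact ⟨size_eq_zero.1 (by omega), ih (by omega)⟩

theorem IsFilled.pairwise_spine {T : DTree n} (h : IsFilled s Y X T) :
    (T.spine s).Pairwise (fun e₁ e₂ => e₂.2 ≠ DTree.leaf → e₁.2.size = Y.card) := by
  induction h with
  | leaf => simp [spine]
  | branch hi hN hP h ih =>
    have h1 := Finset.card_erase_add_one hi
    rw [spine_branch, List.pairwise_cons]
    refine ⟨fun e he hne => ?_, ih⟩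
    rcases h with h | h
    · exact absurd (hP.eq_leaf_of_size_eq (by omega) e he) hne
    · exact h

theorem IsFilled.isB {T : DTree n} (h : IsFilled s Y X T) : IsB s X Y T.size T :=
  ⟨rfl, h.mem_spine, h.nodup_spine, fun _ => h.length_spine, h.pairwise_spine⟩

theorem IsRightPath.isB {T : DTree n} (h : IsRightPath s X T) : IsB s X Y T.size T := by
  refine ⟨rfl, fun e he => ⟨(h.1 e he).1, (h.1 e he).2 ▸ isRightPath_leaf⟩, h.2,
    fun ⟨e, he, hne⟩ => absurd (h.1 e he).2 hne, ?_⟩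
  exact List.Pairwise.imp_of_mem (R := fun _ _ => True)
    (fun _ hb _ hne => absurd (h.1 _ hb).2 hne) (List.pairwise_of_forall fun _ _ => trivial)

theorem isFilled_of_spine {T : DTree n} (h1 : ∀ e ∈ T.spine s, e.1 ∈ X ∧ IsRightPath s Y e.2)
    (h2 : ((T.spine s).map Prod.fst).Nodup) (h3 : (T.spine s).length = X.card)
    (h4 : (T.spine s).Pairwise (fun e₁ e₂ => e₂.2 ≠ leaf → e₁.2.size = Y.card)) :
    IsFilled s Y X T := by
  induction T using branch_induction s generalizing X with
  | leaf =>
    rw [spine, List.length_nil, eq_comm, Finset.card_eq_zero] at h3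
    subst h3
    exact .leaf
  | branch i N P hN hP =>
    rw [spine_branch] at h1 h2 h3 h4
    rw [List.map_cons, List.nodup_cons] at h2
    rw [List.pairwise_cons] at h4
    simp only [List.forall_mem_cons] at h1
    rw [List.length_cons, ← Finset.card_erase_add_one h1.1.1, Nat.add_right_cancel_iff] at h3
    have hP' : IsFilled s Y (X.erase i) P := hP (fun e he => ⟨Finset.mem_erase.2
      ⟨fun hei => h2.1 (List.mem_map.2 ⟨e, he, hei⟩), (h1.2 e he).1⟩, (h1.2 e he).2⟩) h2.2 h3 h4.2
    refine .branch h1.1.1 h1.1.2 hP' ?_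
    by_cases h : ∃ e ∈ P.spine s, e.2 ≠ leaf
    · obtain ⟨e, he, hne⟩ := h
      exact Or.inr (h4.1 e he hne)
    · push Not at h
      left
      have hpath : IsRightPath s (X.erase i) P := ⟨fun e he => ⟨(hP'.mem_spine e he).1, h e he⟩, h2.2⟩
      have := hpath.size_le
      have := hP'.card_le
      have := Finset.card_erase_add_one h1.1.1
      omega

theorem IsB.isRightPath_or_isFilled {t : ℕ} {T : DTree n} (h : IsB s X Y t T) :
    IsRightPath s X T ∨ IsFilled s Y X T := by
  obtain ⟨-, h1, h2, h3, h4⟩ := h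
  by_cases hne : ∃ e ∈ T.spine s, e.2 ≠ leaf
  · exact Or.inr (isFilled_of_spine h1 h2 (h3 hne) h4)
  · push Not at hne
    exact Or.inl ⟨fun e he => ⟨(h1 e he).1, hne e he⟩, h2⟩

theorem IsRightPath.leafSum_saving_right {T : DTree n} (hXY : Disjoint X Y)
    (h : IsCell s X Y D false true A) (hT : IsRightPath s (Y \ D) T) :
    T.leafSum (saving (twoTermDNF s X Y)) A = A.card * termSaving (Y \ D).card T.size := by
  induction T using branch_induction s generalizing D A with
  | leaf => exact h.saving_eq hXY
  | branch i N P hN hP =>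
    obtain ⟨hi, rfl, hT'⟩ := isRightPath_branch.1 hT
    obtain ⟨hY, hD⟩ := Finset.mem_sdiff.1 hi
    have hn := h.filter_neg_right hXY hD hY
    rw [← Finset.sdiff_insert] at hT'
    rw [leafSum_branch, hP (h.filter_pos hD) hT', leafSum, hn.saving_eq hXY, size_branch, size,
      ← card_sdiff_insert_add_one hY hD, zero_add, termSaving_succ,
      h.card_insert hD (h.filter_pos hD), stateSaving]
    ring

theorem maxSaving_succ_of_lt {a b t : ℕ} (h : t ≤ a) :
    maxSaving (a + 1) b (t + 1) = maxSaving a b t / 2 := by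
  rcases lt_trichotomy (t + 1) a with h1 | h1 | h1
  · rw [maxSaving_of_lt h1, maxSaving_of_lt (by omega), zero_div]
  · rw [maxSaving_of_eq h1, maxSaving_of_eq (by omega), show t + 1 + b = t + b + 1 by ring, pow_succ]
    ring
  · obtain rfl : t = a := by omega
    rw [maxSaving_of_le le_rfl, maxSaving_of_le le_rfl, pow_succ]
    simp
    ring

theorem IsRightPath.leafSum_saving_left {T : DTree n} (hXY : Disjoint X Y)
    (h : IsCell s X Y D true true A) (hcard : (X \ D).card ≤ (Y \ D).card)
    (hT : IsRightPath s (X \ D) T) :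
    T.leafSum (saving (twoTermDNF s X Y)) A =
      A.card * maxSaving (X \ D).card (Y \ D).card T.size := by
  induction T using branch_induction s generalizing D A with
  | leaf => rw [leafSum, h.saving_eq hXY, stateSaving, min_eq_left hcard, max_eq_right hcard, size]
  | branch i N P hN hP =>
    obtain ⟨hi, rfl, hT'⟩ := isRightPath_branch.1 hT
    obtain ⟨hX, hD⟩ := Finset.mem_sdiff.1 hi
    have hY : i ∉ Y := Finset.disjoint_left.1 hXY hX
    have hn := h.filter_neg_left hXY hD hX
    have hp := h.filter_pos hD
    have hc := card_sdiff_insert_add_one hX hD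
    have hYD : Y \ insert i D = Y \ D := Finset.sdiff_insert_of_notMem hY D
    rw [← Finset.sdiff_insert] at hT'
    have hle := hT'.size_le
    rw [leafSum_branch, hP hp (by rw [hYD]; omega) hT', leafSum, hn.saving_eq hXY, size_branch, size,
      h.card_insert hD hp, h.card_insert hD hn, hYD, zero_add, ← hc, maxSaving_succ_of_lt hle,
      stateSaving, termSaving, if_neg (by omega)]
    ring

theorem IsFilled.leafSum_saving {T : DTree n} {X' : Finset (Fin n)} (hXY : Disjoint X Y)
    (h : IsCell s X Y D true true A) (hYD : Y \ D = Y) (hX' : X \ D = X')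
    (hcard : X'.card ≤ Y.card) (hT : IsFilled s Y X' T) :
    T.leafSum (saving (twoTermDNF s X Y)) A = A.card * maxSaving X'.card Y.card T.size := by
  induction hT generalizing D A with
  | leaf => simp [leafSum, h.saving_eq hXY, stateSaving, hX', maxSaving_zero_left]
  | @branch X' i N P hi hN hP hor ih =>
    have hi' := hi
    rw [← hX'] at hi'
    obtain ⟨hX, hD⟩ := Finset.mem_sdiff.1 hi'
    have hY : i ∉ Y := Finset.disjoint_left.1 hXY hX
    have hn := h.filter_neg_left hXY hD hX
    have hp := h.filter_pos hD
    have hc := Finset.card_erase_add_one hi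
    have hYD' : Y \ insert i D = Y := (Finset.sdiff_insert_of_notMem hY D).trans hYD
    have hle := hP.card_le
    rw [leafSum_branch, ih hp hYD' (by rw [Finset.sdiff_insert, hX']) (by omega),
      IsRightPath.leafSum_saving_right hXY hn (by rwa [hYD']), size_branch, hYD',
      h.card_insert hD hp, h.card_insert hD hn, ← hc]
    have hNle := hN.size_le
    rcases hNle.eq_or_lt with hN' | hN'
    · rw [hN', termSaving, if_pos le_rfl, add_comm Y.card, maxSaving_succ_full hle (by omega)]
      ring
    -- An incomplete `Y`-path saves nothing, and everything below it is bare, so the count of full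
    -- paths is zero.
    · have hPs : P.size = (X'.erase i).card := by omega
      rw [termSaving, if_neg (by omega), hPs, maxSaving_of_le le_rfl, maxSaving_of_le (by omega),
        show N.size + (X'.erase i).card + 1 - ((X'.erase i).card + 1) = N.size by omega,
        Nat.div_eq_of_lt hN', pow_succ]
      simp
      ring

theorem IsB.leafSum_saving {t : ℕ} {T : DTree n} (hXY : Disjoint X Y) (hcard : X.card ≤ Y.card)
    (h : IsB s X Y t T) : T.leafSum (saving (twoTermDNF s X Y)) Finset.univ =
      (Finset.univ : Finset (Input n)).card * maxSaving X.card Y.card t := by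
  obtain rfl : T.size = t := h.1
  have hu := isCell_univ s X Y
  rcases h.isRightPath_or_isFilled with h | h
  · simpa using IsRightPath.leafSum_saving_left (T := T) hXY hu (by simpa using hcard)
      (by simpa using h)
  · exact IsFilled.leafSum_saving hXY hu (by simp) (by simp) hcard h

theorem IsB.isOptimal {t : ℕ} {T : DTree n} (hXY : Disjoint X Y) (hcard : X.card ≤ Y.card)
    (h : IsB s X Y t T) : IsOptimal (twoTermDNF s X Y) t T := by
  refine ⟨h.1.le, fun S hS => ?_⟩
  rw [err_eq, err_eq]
  gcongr
  have h1 := leafSum_saving_add (twoTermDNF s X Y) T Finset.univ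
  have h2 := leafSum_saving_add (twoTermDNF s X Y) S Finset.univ
  have h3 := h.leafSum_saving hXY hcard
  have hu := isCell_univ s X Y
  have h4 := hu.leafSum_saving_le hXY S
  have h5 := mul_le_mul_of_nonneg_left
    (stateSaving_mono true true X.card Y.card hS) hu.card_pos.le
  simp only [Finset.sdiff_empty] at h4
  simp only [stateSaving, min_eq_left hcard, max_eq_right hcard] at h4 h5
  linarith

/-- At this size all `|X|` negative paths are full, and the saving equals the number of inputs with
value `1`. -/
theorem IsB.err_eq_zero {T : DTree n} (hXY : Disjoint X Y) (hcard : X.card ≤ Y.card)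
    (hY : Y.Nonempty) (h : IsB s X Y (X.card * (Y.card + 1)) T) :
    T.err (twoTermDNF s X Y) = 0 := by
  have h1 := leafSum_saving_add (twoTermDNF s X Y) T Finset.univ
  rw [h.leafSum_saving hXY hcard, (isCell_univ s X Y).card_true hXY, maxSaving_of_le (by nlinarith),
    show X.card * (Y.card + 1) - X.card = X.card * Y.card by rw [Nat.mul_succ]; omega,
    Nat.mul_div_cancel _ hY.card_pos, min_self] at h1
  simp only [Finset.sdiff_empty, termProb_true, orProb] at h1
  rw [err_eq, div_eq_zero_iff]
  left
  linarith

end DTree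

/-! ### Entropy gains at a single leaf -/

theorem two_mul_half_pow {a b : ℕ} (h : a + 1 = b) : 2 * ((1 : ℝ) / 2) ^ b = (1 / 2) ^ a := by
  rw [← h, pow_succ]; ring

theorem half_pow_le_half {a : ℕ} (h : 0 < a) : ((1 : ℝ) / 2) ^ a ≤ 1 / 2 := by
  simpa using half_pow_le_half_pow (show 1 ≤ a from h)

theorem termGain_zero_right (u : ℝ) :
    termGain u 0 = Real.binEntropy u - Real.binEntropy (2 * u) / 2 := by
  simp [termGain, orProb]

theorem cellEntropy_nonneg (f : Input n → Bool) (A : Finset (Input n)) : 0 ≤ cellEntropy f A := by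
  refine mul_nonneg (by positivity) (Real.binEntropy_nonneg (by positivity) ?_)
  refine div_le_one_of_le₀ ?_ (by positivity)
  exact_mod_cast Finset.card_filter_le _ _

/-- Used for cells on which the function is constant: their entropy vanishes, so no split of them
gains. -/
theorem gainOn_leaf_le (f : Input n → Bool) (A : Finset (Input n)) (i : Fin n) :
    leaf.gainOn f A [] i ≤ cellEntropy f A := by
  rw [gainOn_leaf f (fun _ => true)]
  have h1 := cellEntropy_nonneg f (A.filter (fun x => x i = !true))
  have h2 := cellEntropy_nonneg f (A.filter (fun x => x i = true))
  linarith

namespace IsCell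

variable {s : Fin n → Bool} {X Y D : Finset (Fin n)} {α β : Bool} {A : Finset (Input n)}

theorem gainOn_leaf_left (hXY : Disjoint X Y) (h : IsCell s X Y D true β A) {i : Fin n}
    (hD : i ∉ D) (hX : i ∈ X) : leaf.gainOn (twoTermDNF s X Y) A [] i =
      A.card * termGain ((1 / 2) ^ (X \ D).card) (termProb β (Y \ D).card) := by
  have hn := h.filter_neg_left hXY hD hX
  have hp := h.filter_pos hD
  rw [gainOn_leaf _ s, h.cellEntropy hXY, hn.cellEntropy hXY, hp.cellEntropy hXY,
    h.card_insert hD hn, h.card_insert hD hp,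
    Finset.sdiff_insert_of_notMem (Finset.disjoint_left.1 hXY hX), termGain,
    two_mul_half_pow (card_sdiff_insert_add_one hX hD), termProb_true, termProb_true,
    termProb_false]
  ring

theorem gainOn_leaf_right (hXY : Disjoint X Y) (h : IsCell s X Y D α true A) {i : Fin n}
    (hD : i ∉ D) (hY : i ∈ Y) : leaf.gainOn (twoTermDNF s X Y) A [] i =
      A.card * termGain ((1 / 2) ^ (Y \ D).card) (termProb α (X \ D).card) := by
  rw [twoTermDNF_comm]
  exact h.comm.gainOn_leaf_left hXY.symm hD hY

/-- Neither value of `i` changes the status of a term, so both children have the conditional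
probability of the parent. This includes `X`-features once the `X`-term is false. -/
theorem gainOn_leaf_other (hXY : Disjoint X Y) (h : IsCell s X Y D α β A) {i : Fin n} (hD : i ∉ D)
    (hX : i ∈ X → α = false) (hY : i ∉ Y) : leaf.gainOn (twoTermDNF s X Y) A [] i = 0 := by
  have hf : ∀ b, IsCell s X Y (insert i D) α β (A.filter (fun x => x i = b)) := fun b =>
    h.filter hD b (by cases α <;> simp_all) (by simp [hY])
  have e : termProb α (X \ insert i D).card = termProb α (X \ D).card := by
    by_cases hX' : i ∈ X
    · simp [hX hX']
    · rw [Finset.sdiff_insert_of_notMem hX']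
  rw [gainOn_leaf _ s, h.cellEntropy hXY, (hf _).cellEntropy hXY, (hf _).cellEntropy hXY,
    h.card_insert hD (hf _), h.card_insert hD (hf _), Finset.sdiff_insert_of_notMem hY, e]
  ring

theorem gainOn_leaf_nonpos_of_false (hXY : Disjoint X Y) (h : IsCell s X Y D false false A)
    (i : Fin n) : leaf.gainOn (twoTermDNF s X Y) A [] i ≤ 0 := by
  refine (gainOn_leaf_le _ _ _).trans_eq ?_
  rw [h.cellEntropy hXY]
  simp [orProb]

theorem gainOn_leaf_nonpos_of_true (hXY : Disjoint X Y) (h : IsCell s X Y D true β A)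
    (hX : X \ D = ∅) (i : Fin n) : leaf.gainOn (twoTermDNF s X Y) A [] i ≤ 0 := by
  refine (gainOn_leaf_le _ _ _).trans_eq ?_
  rw [h.cellEntropy hXY, hX]
  simp [orProb]

theorem gainOn_leaf_right_of_false (hXY : Disjoint X Y) (h : IsCell s X Y D false true A)
    {i : Fin n} (hD : i ∉ D) (hY : i ∈ Y) : leaf.gainOn (twoTermDNF s X Y) A [] i =
      A.card * (Real.binEntropy ((1 / 2) ^ (Y \ D).card) -
        Real.binEntropy (2 * (1 / 2) ^ (Y \ D).card) / 2) := by
  rw [h.gainOn_leaf_right hXY hD hY, termProb_false, termGain_zero_right]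

end IsCell

/-! ### Thresholds that separate the best splits -/

namespace DTree

variable {s : Fin n → Bool} {X Y Z D : Finset (Fin n)} {α β : Bool} {A : Finset (Input n)}

theorem split_leaf (s : Fin n → Bool) (i : Fin n) : leaf.split [] i = branch s i leaf leaf := by
  cases h : s i <;> simp [branch, h, split]

theorem isRightPath_split_leaf {i : Fin n} (hi : i ∈ Z) : IsRightPath s Z (leaf.split [] i) := by
  rw [split_leaf s]
  exact isRightPath_branch.2 ⟨hi, rfl, isRightPath_leaf⟩

theorem forall_mem_leaves_leaf {p : List Bool → Prop} : (∀ l ∈ (leaf : DTree n).leaves, p l) ↔ p [] := by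
  simp [leaves]

/-- The gains within a `Y`-path, where the term on `X` is false. -/
theorem IsRightPath.gainOn_right {T : DTree n} (hXY : Disjoint X Y)
    (h : IsCell s X Y D false true A) (hT : IsRightPath s (Y \ D) T) :
    ∀ l ∈ T.leaves, ∀ i, i ∉ D → i ∉ T.pathFeatures l →
      T.gainOn (twoTermDNF s X Y) A l i ≤ 0 ∨
      (T.gainOn (twoTermDNF s X Y) A l i ≤ 2 * (A.card * ((1 / 2) ^ (Y \ D).card * Real.log 2)) ∧
        IsRightPath s (Y \ D) (T.split l i) ∧ (T.split l i).size = T.size + 1) := by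
  induction T using branch_induction s generalizing D A with
  | leaf =>
    rw [forall_mem_leaves_leaf]
    intro i hD _
    by_cases hY : i ∈ Y
    · have hi := Finset.mem_sdiff.2 ⟨hY, hD⟩
      refine Or.inr ⟨?_, isRightPath_split_leaf hi, by simp [split, size]⟩
      rw [h.gainOn_leaf_right_of_false hXY hD hY]
      have := mul_le_mul_of_nonneg_left (binEntropy_sub_half_le (half_pow_pos (Y \ D).card)
        (half_pow_le_half (Finset.card_pos.2 ⟨i, hi⟩))) h.card_pos.le
      linarith
    · exact Or.inl (h.gainOn_leaf_other hXY hD (fun _ => rfl) hY).le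
  | branch j N P hN hP =>
    obtain ⟨hj, rfl, hT'⟩ := isRightPath_branch.1 hT
    obtain ⟨hY, hD⟩ := Finset.mem_sdiff.1 hj
    have hn := h.filter_neg_right hXY hD hY
    have hp := h.filter_pos hD
    have hc := card_sdiff_insert_add_one hY hD
    intro l hl i hi hpath
    rcases (mem_leaves_branch s j leaf P).1 hl with ⟨w, hw, rfl⟩ | ⟨w, hw, rfl⟩
    · left
      rw [gainOn_branch_neg]
      rw [leaves, Finset.mem_singleton] at hw
      subst hw
      exact hn.gainOn_leaf_nonpos_of_false hXY i
    · rw [pathFeatures_branch_pos, Finset.mem_insert, not_or] at hpath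
      rw [← Finset.sdiff_insert] at hT'
      rw [gainOn_branch_pos, split_branch_pos, size_branch, size_branch, isRightPath_branch,
        ← Finset.sdiff_insert]
      rcases hP hp hT' w hw i (by simp [hi, hpath.1]) hpath.2 with h1 | ⟨h1, h2, h3⟩
      · exact Or.inl h1
      · refine Or.inr ⟨?_, ⟨hj, rfl, h2⟩, by omega⟩
        rw [h.card_insert hD hp] at h1
        -- The cell halves while the probability of the remaining term doubles, so the bound is the
        -- same all along the path.
        rw [← hc, pow_succ]
        linarith

/-- The witness is the leaf at the positive end of the path, split on a literal still missing there.
-/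
theorem IsRightPath.exists_lt_gainOn_right {T : DTree n} (hXY : Disjoint X Y)
    (h : IsCell s X Y D false true A) (hT : IsRightPath s (Y \ D) T) (hs : T.size < (Y \ D).card) :
    ∃ l ∈ T.leaves, ∃ i, i ∉ D ∧ i ∉ T.pathFeatures l ∧
      A.card * ((1 / 2) ^ (Y \ D).card * Real.log 2) < T.gainOn (twoTermDNF s X Y) A l i := by
  induction T using branch_induction s generalizing D A with
  | leaf =>
    obtain ⟨i, hi⟩ := Finset.card_pos.1 (show 0 < (Y \ D).card by omega)
    obtain ⟨hY, hD⟩ := Finset.mem_sdiff.1 hi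
    refine ⟨[], by simp [leaves], i, hD, by simp [pathFeatures], ?_⟩
    rw [h.gainOn_leaf_right_of_false hXY hD hY]
    exact mul_lt_mul_of_pos_left (lt_binEntropy_sub_half (half_pow_pos (Y \ D).card)
      (half_pow_le_half (Finset.card_pos.2 ⟨i, hi⟩))) h.card_pos
  | branch j N P hN hP =>
    obtain ⟨hj, rfl, hT'⟩ := isRightPath_branch.1 hT
    obtain ⟨hY, hD⟩ := Finset.mem_sdiff.1 hj
    have hp := h.filter_pos hD
    have hc := card_sdiff_insert_add_one hY hD
    rw [size_branch] at hs
    rw [← Finset.sdiff_insert] at hT'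
    obtain ⟨w, hw, i, hi, hpath, hg⟩ := hP hp hT' (by omega)
    rw [Finset.mem_insert, not_or] at hi
    refine ⟨s j :: w, (mem_leaves_branch s j leaf P).2 (Or.inr ⟨w, hw, rfl⟩), i, hi.2, ?_, ?_⟩
    · rw [pathFeatures_branch_pos]
      simp [hi.1, hpath]
    · rw [gainOn_branch_pos]
      refine lt_of_eq_of_lt ?_ hg
      rw [h.card_insert hD hp, ← hc, pow_succ]
      ring

/-- The factor two in the upper bound for a `Y`-path cancels the halving of the cell at the first
negative child; deeper subtrees have smaller cells. -/
theorem IsFilled.gainOn_le {T : DTree n} {X' : Finset (Fin n)} (hXY : Disjoint X Y)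
    (h : IsCell s X Y D true true A) (hYD : Y \ D = Y) (hX' : X \ D = X')
    (hT : IsFilled s Y X' T) :
    ∀ l ∈ T.leaves, ∀ i, i ∉ D → i ∉ T.pathFeatures l →
      T.gainOn (twoTermDNF s X Y) A l i ≤ A.card * ((1 / 2) ^ Y.card * Real.log 2) := by
  have hlog : 0 < Real.log 2 := Real.log_pos (by norm_num)
  induction hT generalizing D A with
  | leaf =>
    rw [forall_mem_leaves_leaf]
    intro i _ _
    exact (h.gainOn_leaf_nonpos_of_true hXY hX' i).trans (by positivity)
  | @branch X' j N P hj hN hP hor ih =>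
    have hj' := hj
    rw [← hX'] at hj'
    obtain ⟨hX, hD⟩ := Finset.mem_sdiff.1 hj'
    have hY : j ∉ Y := Finset.disjoint_left.1 hXY hX
    have hn := h.filter_neg_left hXY hD hX
    have hp := h.filter_pos hD
    have hYD' : Y \ insert j D = Y := (Finset.sdiff_insert_of_notMem hY D).trans hYD
    have hpos : 0 < (A.card : ℝ) * ((1 / 2) ^ Y.card * Real.log 2) := by
      have := h.card_pos
      positivity
    intro l hl i hi hpath
    rcases (mem_leaves_branch s j N P).1 hl with ⟨w, hw, rfl⟩ | ⟨w, hw, rfl⟩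
    · rw [pathFeatures_branch_neg, Finset.mem_insert, not_or] at hpath
      rw [gainOn_branch_neg]
      rcases IsRightPath.gainOn_right hXY hn (by rwa [hYD']) w hw i (by simp [hi, hpath.1]) hpath.2
        with h1 | ⟨h1, -, -⟩
      · linarith
      · rw [h.card_insert hD hn, hYD'] at h1
        linarith
    · rw [pathFeatures_branch_pos, Finset.mem_insert, not_or] at hpath
      rw [gainOn_branch_pos]
      have h1 := ih hp hYD' (by rw [Finset.sdiff_insert, hX']) w hw i (by simp [hi, hpath.1]) hpath.2
      rw [h.card_insert hD hp] at h1
      linarith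

/-- The best splits of a filled tree extend its first `Y`-path that is not full. -/
theorem IsFilled.exists_threshold {T : DTree n} {X' : Finset (Fin n)} (hXY : Disjoint X Y)
    (h : IsCell s X Y D true true A) (hYD : Y \ D = Y) (hX' : X \ D = X')
    (hT : IsFilled s Y X' T) (hs : T.size < X'.card * (Y.card + 1)) :
    ∃ θ : ℝ, 0 ≤ θ ∧
      (∃ l ∈ T.leaves, ∃ i, i ∉ D ∧ i ∉ T.pathFeatures l ∧
        θ < T.gainOn (twoTermDNF s X Y) A l i) ∧
      ∀ l ∈ T.leaves, ∀ i, i ∉ D → i ∉ T.pathFeatures l → θ < T.gainOn (twoTermDNF s X Y) A l i →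
        IsFilled s Y X' (T.split l i) ∧ (T.split l i).size = T.size + 1 := by
  have hlog : 0 < Real.log 2 := Real.log_pos (by norm_num)
  induction hT generalizing D A with
  | leaf => simp at hs
  | @branch X' j N P hj hN hP hor ih =>
    have hj' := hj
    rw [← hX'] at hj'
    obtain ⟨hX, hD⟩ := Finset.mem_sdiff.1 hj'
    have hY : j ∉ Y := Finset.disjoint_left.1 hXY hX
    have hn := h.filter_neg_left hXY hD hX
    have hp := h.filter_pos hD
    have hYD' : Y \ insert j D = Y := (Finset.sdiff_insert_of_notMem hY D).trans hYD
    have hXD' : X \ insert j D = X'.erase j := by rw [Finset.sdiff_insert, hX']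
    have hN' : IsRightPath s (Y \ insert j D) N := by rwa [hYD']
    have hright := IsRightPath.gainOn_right hXY hn hN'
    have hc := Finset.card_erase_add_one hj
    rw [size_branch] at hs
    rcases hN.size_le.eq_or_lt with hfull | hlt
    -- A full `Y`-path offers no positive gain, since its extension would have too many nodes; hence
    -- the threshold from below still works, as `0 ≤ θ`.
    · obtain ⟨θ, h0, ⟨w, hw, i, hi, hpath, hg⟩, hall⟩ := ih hp hYD' hXD' (by
        rw [← hc, Nat.succ_mul] at hs; omega)
      refine ⟨θ, h0, ⟨s j :: w, (mem_leaves_branch s j N P).2 (Or.inr ⟨w, hw, rfl⟩), i, ?_⟩, ?_⟩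
      · rw [Finset.mem_insert, not_or] at hi
        rw [pathFeatures_branch_pos, gainOn_branch_pos]
        simp [hi, hpath, hg]
      · intro l hl i hi hpath hg
        rcases (mem_leaves_branch s j N P).1 hl with ⟨w, hw, rfl⟩ | ⟨w, hw, rfl⟩
        · rw [pathFeatures_branch_neg, Finset.mem_insert, not_or] at hpath
          rw [gainOn_branch_neg] at hg
          rcases hright w hw i (by simp [hi, hpath.1]) hpath.2 with h1 | ⟨-, h2, h3⟩
          · linarith
          · have := h2.size_le
            rw [hYD'] at this
            omega
        · rw [pathFeatures_branch_pos, Finset.mem_insert, not_or] at hpath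
          rw [gainOn_branch_pos] at hg
          obtain ⟨h1, h2⟩ := hall w hw i (by simp [hi, hpath.1]) hpath.2 hg
          rw [split_branch_pos, size_branch, size_branch]
          exact ⟨.branch hj hN h1 (Or.inr hfull), by omega⟩
    · have hbare : P.size + 1 = X'.card := by omega
      -- This is at once the strict lower bound for the best gain in `N` and the upper bound for all
      -- gains in `P`.
      refine ⟨A.card * ((1 / 2) ^ Y.card * Real.log 2) / 2, ?_, ?_, ?_⟩
      · have := h.card_pos
        positivity
      · obtain ⟨w, hw, i, hi, hpath, hg⟩ := IsRightPath.exists_lt_gainOn_right hXY hn hN'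
          (by rwa [hYD'])
        refine ⟨(!s j) :: w, (mem_leaves_branch s j N P).2 (Or.inl ⟨w, hw, rfl⟩), i, ?_⟩
        rw [Finset.mem_insert, not_or] at hi
        rw [pathFeatures_branch_neg, gainOn_branch_neg, Finset.mem_insert, not_or]
        refine ⟨hi.2, ⟨hi.1, hpath⟩, ?_⟩
        rw [h.card_insert hD hn, hYD'] at hg
        linarith
      · intro l hl i hi hpath hg
        rcases (mem_leaves_branch s j N P).1 hl with ⟨w, hw, rfl⟩ | ⟨w, hw, rfl⟩
        · rw [pathFeatures_branch_neg, Finset.mem_insert, not_or] at hpath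
          rw [gainOn_branch_neg] at hg
          rcases hright w hw i (by simp [hi, hpath.1]) hpath.2 with h1 | ⟨-, h2, h3⟩
          · have := h.card_pos
            have : 0 < (A.card : ℝ) * ((1 / 2) ^ Y.card * Real.log 2) / 2 := by positivity
            linarith
          · rw [hYD'] at h2
            rw [split_branch_neg, size_branch, size_branch]
            exact ⟨.branch hj h2 hP (Or.inl hbare), by omega⟩
        · rw [pathFeatures_branch_pos, Finset.mem_insert, not_or] at hpath
          rw [gainOn_branch_pos] at hg
          have h1 := hP.gainOn_le hXY hp hYD' hXD' w hw i (by simp [hi, hpath.1]) hpath.2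
          rw [h.card_insert hD hp] at h1
          linarith

/-- The best splits of an `X`-path that is not complete extend it. -/
theorem IsRightPath.exists_threshold {T : DTree n} (hXY : Disjoint X Y)
    (h : IsCell s X Y D true true A) (hYD : Y \ D = Y) (hcard : (X \ D).card ≤ Y.card)
    (hT : IsRightPath s (X \ D) T) (hs : T.size < (X \ D).card)
    (hleaf : T = leaf → (X \ D).card < Y.card) :
    ∃ M : ℝ, A.card * ((1 / 2) ^ (X \ D).card / (2 * (1 / 2) ^ Y.card) *
        (Real.binEntropy ((1 / 2) ^ Y.card) - Real.binEntropy (2 * (1 / 2) ^ Y.card) / 2)) < M ∧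
      (∃ l ∈ T.leaves, ∃ i, i ∉ D ∧ i ∉ T.pathFeatures l ∧
        M ≤ T.gainOn (twoTermDNF s X Y) A l i) ∧
      ∀ l ∈ T.leaves, ∀ i, i ∉ D → i ∉ T.pathFeatures l → M ≤ T.gainOn (twoTermDNF s X Y) A l i →
        IsRightPath s (X \ D) (T.split l i) ∧ (T.split l i).size = T.size + 1 := by
  induction T using branch_induction s generalizing D A with
  | leaf =>
    have hlt := hleaf rfl
    rw [size] at hs
    have hA := h.card_pos
    have hu := half_pow_le_half hs
    have hwu : ((1 : ℝ) / 2) ^ Y.card ≤ (1 / 2) ^ (X \ D).card / 2 := by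
      have := half_pow_le_half_pow (show (X \ D).card + 1 ≤ Y.card from hlt)
      rw [pow_succ] at this
      linarith
    have hw := half_pow_pos Y.card
    refine ⟨A.card * termGain ((1 / 2) ^ (X \ D).card) ((1 / 2) ^ Y.card),
      mul_lt_mul_of_pos_left (lt_termGain hw hwu hu) hA, ?_, ?_⟩
    · obtain ⟨i, hi⟩ := Finset.card_pos.1 hs
      obtain ⟨hX, hD⟩ := Finset.mem_sdiff.1 hi
      refine ⟨[], by simp [leaves], i, hD, by simp [pathFeatures], ?_⟩
      rw [h.gainOn_leaf_left hXY hD hX, hYD, termProb_true]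
    · rw [forall_mem_leaves_leaf]
      intro i hD _ hg
      by_cases hX : i ∈ X
      · exact ⟨isRightPath_split_leaf (Finset.mem_sdiff.2 ⟨hX, hD⟩), by simp [split, size]⟩
      · exfalso
        by_cases hY : i ∈ Y
        · rw [h.gainOn_leaf_right hXY hD hY, hYD, termProb_true] at hg
          have := termGain_lt_termGain hw (show _ < ((1 : ℝ) / 2) ^ (X \ D).card by linarith) hu
          have := mul_lt_mul_of_pos_left this hA
          linarith
        · rw [h.gainOn_leaf_other hXY hD (fun h => absurd h hX) hY] at hg
          have := mul_pos hA (termGain_pos (half_pow_pos (X \ D).card) hu hw.le (by linarith))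
          linarith
  | branch j N P hN hP =>
    obtain ⟨hj, rfl, hT'⟩ := isRightPath_branch.1 hT
    obtain ⟨hX, hD⟩ := Finset.mem_sdiff.1 hj
    have hY : j ∉ Y := Finset.disjoint_left.1 hXY hX
    have hn := h.filter_neg_left hXY hD hX
    have hp := h.filter_pos hD
    have hYD' : Y \ insert j D = Y := (Finset.sdiff_insert_of_notMem hY D).trans hYD
    have hc := card_sdiff_insert_add_one hX hD
    rw [← Finset.sdiff_insert] at hT'
    rw [size_branch, size] at hs
    obtain ⟨M, hM, ⟨w, hw, i, hi, hpath, hg⟩, hall⟩ :=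
      -- Below the first node the remaining `X`-term is strictly shorter than the `Y`-term, so equal
      -- lengths matter only at a bare leaf.
      hP hp hYD' (by omega) hT' (by omega) (fun _ => by omega)
    set w₀ : ℝ := (1 / 2) ^ Y.card with hw₀
    set g : ℝ := Real.binEntropy w₀ - Real.binEntropy (2 * w₀) / 2 with hg₀
    have hw₀p : 0 < w₀ := half_pow_pos _
    have hgp : 0 < g := by
      have := lt_binEntropy_sub_half hw₀p (half_pow_le_half (show 0 < Y.card by omega))
      have : 0 < w₀ * Real.log 2 := mul_pos hw₀p (Real.log_pos (by norm_num))
      linarith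
    have hA := h.card_pos
    rw [h.card_insert hD hp] at hM
    -- Cell size times `X`-term probability is invariant along the path, so the bound obtained at
    -- its end holds unchanged here.
    have hM' : A.card * ((1 / 2) ^ (X \ D).card / (2 * w₀) * g) < M := by
      refine lt_of_eq_of_lt ?_ hM
      rw [← hc, pow_succ]
      ring
    -- The left side is the gain of a `Y`-literal at the negative leaf of `j`.
    have hMg : A.card / 2 * g < M := by
      refine lt_of_le_of_lt ?_ hM'
      have h1 : w₀ ≤ (1 / 2) ^ (X \ D).card := half_pow_le_half_pow hcard
      have h2 : 1 / 2 ≤ (1 / 2) ^ (X \ D).card / (2 * w₀) := by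
        rw [le_div_iff₀ (by positivity)]
        linarith
      have := mul_le_mul_of_nonneg_left (mul_le_mul_of_nonneg_right h2 hgp.le) hA.le
      linarith
    refine ⟨M, hM', ⟨s j :: w, (mem_leaves_branch s j leaf P).2 (Or.inr ⟨w, hw, rfl⟩), i, ?_⟩, ?_⟩
    · rw [Finset.mem_insert, not_or] at hi
      rw [pathFeatures_branch_pos, gainOn_branch_pos]
      simp [hi, hpath, hg]
    · intro l hl i hi hpath hg
      rcases (mem_leaves_branch s j leaf P).1 hl with ⟨w, hw, rfl⟩ | ⟨w, hw, rfl⟩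
      · exfalso
        rw [leaves, Finset.mem_singleton] at hw
        subst hw
        rw [pathFeatures_branch_neg, Finset.mem_insert, not_or] at hpath
        have hi' : i ∉ insert j D := by simp [hi, hpath.1]
        rw [gainOn_branch_neg] at hg
        by_cases hiY : i ∈ Y
        · rw [hn.gainOn_leaf_right_of_false hXY hi' hiY, hYD', h.card_insert hD hn, ← hw₀,
            ← hg₀] at hg
          linarith
        · rw [hn.gainOn_leaf_other hXY hi' (fun _ => rfl) hiY] at hg
          have : 0 < A.card / 2 * g := by positivity
          linarith
      · rw [pathFeatures_branch_pos, Finset.mem_insert, not_or] at hpath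
        rw [gainOn_branch_pos] at hg
        obtain ⟨h1, h2⟩ := hall w hw i (by simp [hi, hpath.1]) hpath.2 hg
        rw [split_branch_pos, size_branch, size_branch, isRightPath_branch, ← Finset.sdiff_insert]
        exact ⟨⟨hj, rfl, h1⟩, by omega⟩

/-! ### TopDown -/

/-- Independence of tie-breaking: whichever maximizer is chosen, its gain reaches `M`. A pair
reaching `M` also excludes that the run is stuck. -/
theorem IsTopDownStep.of_threshold {f : Input n → Bool} {T T' : DTree n} {Q : DTree n → Prop}
    (hstep : IsTopDownStep f T T') {M : ℝ}
    (hex : ∃ l ∈ T.leaves, ∃ i, i ∉ T.pathFeatures l ∧ M ≤ T.gainOn f Finset.univ l i)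
    (hall : ∀ l ∈ T.leaves, ∀ i, i ∉ T.pathFeatures l → M ≤ T.gainOn f Finset.univ l i →
      Q (T.split l i)) : Q T' := by
  obtain ⟨l', hl', i', hi', hM⟩ := hex
  rcases hstep with ⟨l, hl, i, hi, hmax, rfl⟩ | ⟨hno, -⟩
  · exact hall l hl i hi (hM.trans ((gain_le_gain_iff f T l' l i' i).1 (hmax l' hl' i' hi')))
  · exact absurd (hno l' hl' i') hi'

theorem IsB.step {t : ℕ} {T T' : DTree n} (hXY : Disjoint X Y) (hcard : X.card ≤ Y.card)
    (h : IsB s X Y t T) (h1 : 1 ≤ t) (h2 : t < X.card * (Y.card + 1))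
    (hstep : IsTopDownStep (twoTermDNF s X Y) T T') : IsB s X Y (t + 1) T' := by
  have hu := isCell_univ s X Y
  obtain rfl : T.size = t := h.1
  -- A complete bare `X`-path counts as filled, because its next split starts a `Y`-path.
  have hcase : (IsRightPath s X T ∧ T.size < X.card) ∨ IsFilled s Y X T := by
    rcases h.isRightPath_or_isFilled with h | h
    · rcases h.size_le.eq_or_lt with he | hlt
      · exact Or.inr (h.isFilled he)
      · exact Or.inl ⟨h, hlt⟩
    · exact Or.inr h
  rcases hcase with ⟨hT, hlt⟩ | hT
  · obtain ⟨M, -, ⟨l, hl, i, -, hi, hM⟩, hall⟩ := IsRightPath.exists_threshold (T := T) hXY hu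
      (by simp) (by simpa using hcard) (by simpa using hT) (by simpa using hlt)
      (fun e => by rw [e, size] at h1; omega)
    refine hstep.of_threshold ⟨l, hl, i, hi, hM⟩ fun l hl i hi hM => ?_
    obtain ⟨h3, h4⟩ := hall l hl i (by simp) hi hM
    rw [Finset.sdiff_empty] at h3
    exact h4 ▸ h3.isB
  · obtain ⟨θ, -, ⟨l, hl, i, -, hi, hM⟩, hall⟩ := hT.exists_threshold hXY hu (by simp) (by simp) h2
    refine hstep.of_threshold ⟨l, hl, i, hi, le_rfl⟩ fun l' hl' i' hi' hM' => ?_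
    obtain ⟨h3, h4⟩ := hall l' hl' i' (by simp) hi' (hM.trans_le hM')
    exact h4 ▸ h3.isB

/-- Only this first split can choose `Y` as the main term, and only for equal lengths, where the two
gains tie. -/
theorem isB_of_step_leaf {T' : DTree n} (hX : X.Nonempty) (hXY : Disjoint X Y)
    (hcard : X.card ≤ Y.card) (hstep : IsTopDownStep (twoTermDNF s X Y) leaf T') :
    IsB s X Y 1 T' ∨ (X.card = Y.card ∧ IsB s Y X 1 T') := by
  have hu := isCell_univ s X Y
  have hA := hu.card_pos
  have hXp := hX.card_pos
  have hsplit : ∀ {Z W : Finset (Fin n)} {i}, i ∈ Z → IsB s Z W 1 (leaf.split [] i) := by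
    intro Z W i hi
    simpa [split, size] using (isRightPath_split_leaf (s := s) hi).isB (Y := W)
  have huh := half_pow_le_half hXp
  have hwh := half_pow_le_half (hXp.trans_le hcard)
  have hw := half_pow_pos Y.card
  refine hstep.of_threshold (M := (Finset.univ : Finset (Input n)).card *
    termGain ((1 / 2) ^ X.card) ((1 / 2) ^ Y.card))
    (Q := fun T => IsB s X Y 1 T ∨ (X.card = Y.card ∧ IsB s Y X 1 T)) ?_ ?_
  · obtain ⟨i, hi⟩ := hX
    refine ⟨[], by simp [leaves], i, by simp [pathFeatures], ?_⟩
    rw [hu.gainOn_leaf_left hXY (by simp) hi]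
    simp
  · rw [forall_mem_leaves_leaf]
    intro i _ hg
    by_cases hiX : i ∈ X
    · exact Or.inl (hsplit hiX)
    · by_cases hiY : i ∈ Y
      · refine Or.inr ⟨hcard.antisymm (not_lt.1 fun hlt => ?_), hsplit hiY⟩
        rw [hu.gainOn_leaf_right hXY (by simp) hiY] at hg
        simp only [Finset.sdiff_empty, termProb_true] at hg
        have := half_pow_le_half_pow (show X.card + 1 ≤ Y.card from hlt)
        rw [pow_succ] at this
        have := half_pow_pos X.card
        have := mul_lt_mul_of_pos_left (termGain_lt_termGain hw
          (show _ < ((1 : ℝ) / 2) ^ X.card by linarith) huh) hA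
        linarith
      · exfalso
        rw [hu.gainOn_leaf_other hXY (by simp) (fun h => absurd h hiX) hiY] at hg
        have := mul_pos hA (termGain_pos (half_pow_pos X.card) huh hw.le (by linarith))
        linarith

theorem IsTopDownRun.isB {T : ℕ → DTree n} (hX : X.Nonempty) (hXY : Disjoint X Y)
    (hcard : X.card ≤ Y.card) (hT : IsTopDownRun (twoTermDNF s X Y) T) {t : ℕ} (h1 : 1 ≤ t)
    (h2 : t ≤ X.card * (Y.card + 1)) :
    IsB s X Y t (T t) ∨ (X.card = Y.card ∧ IsB s Y X t (T t)) := by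
  induction t, h1 using Nat.le_induction with
  | base => exact isB_of_step_leaf hX hXY hcard (hT.1 ▸ hT.2 0)
  | succ t h1 ih =>
    rcases ih (by omega) with h | ⟨he, h⟩
    · exact Or.inl (h.step hXY hcard h1 (by omega) (hT.2 t))
    · refine Or.inr ⟨he, h.step hXY.symm he.ge h1 (by rw [← he] at h2 ⊢; omega) ?_⟩
      rw [← twoTermDNF_comm]
      exact hT.2 t

end DTree

theorem mainTheorem2 (n : ℕ) (s : Fin n → Bool) (X Y : Finset (Fin n))
    (hX : X.Nonempty) (hXY : Disjoint X Y) (hcard : X.card ≤ Y.card) :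
    (∃ T : ℕ → DTree n, DTree.IsTopDownRun (twoTermDNF s X Y) T) ∧
    (∀ T : ℕ → DTree n, DTree.IsTopDownRun (twoTermDNF s X Y) T →
      (∀ t : ℕ, 1 ≤ t → t ≤ X.card * (Y.card + 1) →
        DTree.IsB s X Y t (T t) ∨ (X.card = Y.card ∧ DTree.IsB s Y X t (T t))) ∧
      (∀ t : ℕ, 1 ≤ t → DTree.IsOptimal (twoTermDNF s X Y) t (T t)) ∧
      (∀ t : ℕ, X.card * (Y.card + 1) ≤ t → (T t).err (twoTermDNF s X Y) = 0)) ∧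
    (∀ (t : ℕ) (T : DTree n), 1 ≤ t → DTree.IsB s X Y t T →
      DTree.IsOptimal (twoTermDNF s X Y) t T) := by
  have hY : Y.Nonempty := Finset.card_pos.1 (hX.card_pos.trans_le hcard)
  refine ⟨DTree.exists_isTopDownRun _, fun T hT => ?_, fun t T _ h => h.isOptimal hXY hcard⟩
  have hB := fun t (h1 : 1 ≤ t) h2 => hT.isB hX hXY hcard (t := t) h1 h2
  have hzero : ∀ t : ℕ, X.card * (Y.card + 1) ≤ t → (T t).err (twoTermDNF s X Y) = 0 := by
    intro t ht
    -- Splitting never increases the error under majority labels, so the error stays zero after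
    -- `l(m+1)` steps.
    refine le_antisymm ((hT.err_antitone ht).trans_eq ?_) (DTree.err_nonneg _ _)
    rcases hB _ (Nat.mul_pos hX.card_pos (Nat.succ_pos _)) le_rfl with h | ⟨he, h⟩
    · exact h.err_eq_zero hXY hcard hY
    · rw [twoTermDNF_comm]
      exact DTree.IsB.err_eq_zero (s := s) hXY.symm he.ge hX (by rw [he] at h ⊢; exact h)
  refine ⟨hB, fun t h1 => ?_, hzero⟩
  rcases le_total t (X.card * (Y.card + 1)) with h2 | h2
  · rcases hB t h1 h2 with h | ⟨he, h⟩
    · exact h.isOptimal hXY hcard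
    · rw [twoTermDNF_comm]
      exact h.isOptimal hXY.symm he.ge
  · exact ⟨hT.size_le t, fun S _ => (hzero t h2).trans_le (DTree.err_nonneg _ S)⟩
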